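/- Let $m\ge 0$ be an integer, let $a,b_1,\dots,b_m,A_1,\dots,A_m\in\mathbb C$, $0<\lambda<\infty$, $\mu<1$, and let $\zeta_1,\dots,\zeta_m\in\mathbb C$ be pairwise distinct with $|\zeta_k|=1$ and $\zeta_k\neq 1$ for all $k$. Let $\theta\in(0,\pi)$ be such that the sectors $\{z\ne 0: |\arg z|\le\theta\}$ and $\{z\neq 0:|\arg(z/\zeta_k)|\le\theta\}$, $k=1,\dots,m$, are pairwise disjoint. Suppose that $f$ is an entire function such that, as $|z|\to\infty$, $$ f(z)=\begin{cases} z^a\exp(z^\lambda)\,[1+o(1)] & \text{for } |\arg z|\le\theta,\\ A_k (z/\zeta_k)^{b_k}\exp\bigl((z/\zeta_k)^\lambda\bigr)\,[1+o(1)] & \text{for } |\arg(z/\zeta_k)|\le\theta,\quad k=1,\dots,m,\\ O\bigl(\exp(\mu|z|^\lambda)\bigr) & \text{otherwise,}\end{cases} $$ with each estimate holding uniformly in its sector; here $\arg$ and all powers are the principal ones. Let $$ p_n(z)=\sum_{k=0}^n \frac{f^{(k)}(0)}{k!}z^k,\qquad r_n=\left(\frac n\lambda\right)^{1/\lambda},\qquad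 \operatorname{erfc}(z)=\frac{2}{\sqrt\pi}\int_z^\infty e^{-s^2}\,ds, $$ where the integral is taken along the horizontal half-line from $z$ to $z+\infty$. Then $$ \lim_{n\to\infty}\frac{p_{n-1}\bigl(r_n(1+w/\sqrt n)\bigr)}{f\bigl(r_n(1+w/\sqrt n)\bigr)}=\frac12\operatorname{erfc}\bigl(w\sqrt{\lambda/2}\,\bigr) $$ uniformly for $w$ restricted to any compact subset of $\{\operatorname{Re} w<0\}$ if and only if $$ \operatorname{Re} b_k-\operatorname{Re} a<\frac\lambda2,\qquad k=1,\dots,m. $$ -/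

import Mathlib

open Filter Topology Asymptotics Bornology

noncomputable section

/-- The complementary error function `erfc z = (2 / √π) ∫_z^∞ exp (-s²) ds`, the contour being the
horizontal half-line `s = z + t`, `0 < t < ∞`. -/
def cerfc (z : ℂ) : ℂ :=
  (2 / (Real.sqrt Real.pi : ℂ)) * ∫ t in Set.Ioi (0 : ℝ), Complex.exp (-(z + (t : ℂ)) ^ 2)

/-- The closed sector `|arg (z / ζ)| ≤ θ` (without its vertex, where `arg` is undefined). -/
def closedSector (ζ : ℂ) (θ : ℝ) : Set ℂ :=
  {z | z ≠ 0 ∧ |Complex.arg (z / ζ)| ≤ θ}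

/-- The partial sum `p_n(z) = ∑_{k=0}^n f^{(k)}(0) / k! * z^k`. -/
def maclaurinSum (f : ℂ → ℂ) (n : ℕ) (z : ℂ) : ℂ :=
  ∑ k ∈ Finset.range (n + 1), iteratedDeriv k f 0 / (k.factorial : ℂ) * z ^ k

/-- The scaling radius `r_n = (n / λ)^{1/λ}`. -/
def scalingRadius (lam : ℝ) (n : ℕ) : ℝ :=
  ((n : ℝ) / lam) ^ (1 / lam)

/-- The model growth `A (z/ζ)^b exp ((z/ζ)^λ)` in the direction `ζ`, with principal powers. -/
def directionModel (lam : ℝ) (A b ζ z : ℂ) : ℂ :=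
  A * (z / ζ) ^ b * Complex.exp ((z / ζ) ^ (lam : ℂ))

/-- `f` has the asymptotic behavior, as `|z| → ∞` and uniformly in each of the sets,
* `f z = z^a exp (z^λ) (1 + o(1))` for `|arg z| ≤ θ`,
* `f z = A_k (z/ζ_k)^{b_k} exp ((z/ζ_k)^λ) (1 + o(1))` for `|arg (z/ζ_k)| ≤ θ`,
* `f z = O(exp (μ |z|^λ))` for all other `z`.

`u ~[l] v` means that `u = (1 + o(1)) v` along `l`. -/
structure HasMaximalGrowth {m : ℕ} (f : ℂ → ℂ) (lam mu θ : ℝ) (a : ℂ) (A b ζ : Fin m → ℂ) :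
    Prop where
  main : f ~[cobounded ℂ ⊓ 𝓟 (closedSector 1 θ)] directionModel lam 1 a 1
  other : ∀ k, f ~[cobounded ℂ ⊓ 𝓟 (closedSector (ζ k) θ)] directionModel lam (A k) (b k) (ζ k)
  rest : f =O[cobounded ℂ ⊓ 𝓟 (closedSector 1 θ ∪ ⋃ k, closedSector (ζ k) θ)ᶜ]
    fun z => Real.exp (mu * ‖z‖ ^ lam)

end

/-! Write `z = r_n q` with `q = 1 + w/√n`. Since `Re w < 0`, for large `n` the point `z` lies inside
the circle of radius `r_n`, and Cauchy's formula expresses `f(z) - p_{n-1}(z)` as an integral of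
`f(s) / s^n` over that circle against a kernel with a pole at `z`. The radius satisfies `λ r_n^λ =
n`, so every direction in which `f` has maximal growth gives a saddle point on the circle. Laplace's
method in the variable `φ = t/√n` turns each saddle into a Gaussian integral.

At the saddle in direction 1 the pole is at distance of order `1/√n`, comparable with the width of
the Gaussian. The limiting kernel is `1/(it - w)`, and its Gaussian integral is an error function
(`integral_gaussian_div_sub`); with `erfc x + erfc (-x) = 2` this yields the stated limit. At any
other saddle `ζ` the kernel tends to a nonzero constant, so relative to `f(z)` that saddle
contributes `ζ^{-n} n^β J_n`, where `β = (b - a)/λ - 1/2` and `J_n` has a nonzero limit. The rest of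
the circle is exponentially negligible. Hence `p_{n-1}/f` plus a finite sum of such terms always
tends to `erfc/2` (`HasSaddles.tendsto_section_quotient`).

If every `Re β < 0`, the extra sum vanishes locally uniformly. Conversely, if it vanishes at the
single point `w = -1`, the terms cannot cancel one another: the characters `ζ^{-n}` are distinct
while the amplitudes vary slowly (`re_neg_of_tendsto_sum_characters`).

The sectors may be wide, and then `z^λ` is positive on several rays of one sector, all of which are
saddles. `exists_hasSaddles` splits each sector into narrow ones around these rays. The new rays
inherit the exponent of their sector, so they add no condition. -/

noncomputable section

/-! ### The complementary error function and a Gaussian integral with a pole -/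

section ErrorFunction

open MeasureTheory

/-- A Gaussian dominator in `t` that is uniform for bounded `z`; the exponents differ by `(2 Re z +
t)²/2 + |z|² ≥ 0`. -/
theorem norm_cexp_neg_add_sq (z : ℂ) (t : ℝ) :
    ‖Complex.exp (-(z + (t : ℂ)) ^ 2)‖ ≤ Real.exp (2 * ‖z‖ ^ 2) * Real.exp (-(1 / 2) * t ^ 2) := by
  rw [Complex.norm_exp, ← Real.exp_add]
  apply Real.exp_le_exp.2
  have h : (-(z + (t : ℂ)) ^ 2).re = -(z.re + t) ^ 2 + z.im ^ 2 := by
    simp [pow_two]; ring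
  have h2 : ‖z‖ ^ 2 = z.re ^ 2 + z.im ^ 2 := by
    rw [← Complex.normSq_eq_norm_sq, Complex.normSq_apply]; ring
  rw [h, h2]
  nlinarith [sq_nonneg (2 * z.re + t), sq_nonneg z.im]

theorem integrable_cexp_neg_add_sq (z : ℂ) :
    Integrable fun t : ℝ => Complex.exp (-(z + (t : ℂ)) ^ 2) := by
  refine Integrable.mono' (g := fun t : ℝ => Real.exp (2 * ‖z‖ ^ 2) * Real.exp (-(1 / 2) * t ^ 2))
    ((integrable_exp_neg_mul_sq (by norm_num)).const_mul _) ?_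
    (Eventually.of_forall (norm_cexp_neg_add_sq z))
  exact Continuous.aestronglyMeasurable (by fun_prop)

theorem continuous_cerfc : Continuous cerfc := by
  unfold cerfc
  refine continuous_const.mul (continuous_iff_continuousAt.2 fun z₀ => ?_)
  refine continuousAt_of_dominated
    (bound := fun t : ℝ => Real.exp (2 * (‖z₀‖ + 1) ^ 2) * Real.exp (-(1 / 2) * t ^ 2)) ?_ ?_ ?_ ?_
  · exact Eventually.of_forall fun z => Continuous.aestronglyMeasurable (by fun_prop)
  · filter_upwards [Metric.ball_mem_nhds z₀ one_pos] with z hz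
    refine Eventually.of_forall fun t => (norm_cexp_neg_add_sq z t).trans ?_
    have : ‖z‖ ≤ ‖z₀‖ + 1 := by
      have := norm_sub_norm_le z z₀
      have := mem_ball_iff_norm.1 hz
      linarith
    gcongr
  · exact ((integrable_exp_neg_mul_sq (by norm_num)).const_mul _).integrableOn
  · exact Eventually.of_forall fun t => Continuous.continuousAt (by fun_prop)

/-- The reflection `t ↦ -t` turns the second integral into the missing half of a full Gaussian
integral along a horizontal line. -/
theorem cerfc_add_cerfc_neg (z : ℂ) : cerfc z + cerfc (-z) = 2 := by
  have h1 : ∫ t in Set.Ioi (0 : ℝ), Complex.exp (-(-z + (t : ℂ)) ^ 2)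
      = ∫ t in Set.Iic (0 : ℝ), Complex.exp (-(z + (t : ℂ)) ^ 2) := by
    rw [← neg_zero, ← integral_comp_neg_Iic, neg_zero]
    congr 1; ext t; congr 1; push_cast; ring
  have h2 : ∫ t : ℝ, Complex.exp (-(z + (t : ℂ)) ^ 2) = (Real.sqrt Real.pi : ℂ) := by
    have := integral_cexp_quadratic (b := -1) (by simp) (-(2 * z)) (-z ^ 2)
    calc ∫ t : ℝ, Complex.exp (-(z + (t : ℂ)) ^ 2)
        = ∫ t : ℝ, Complex.exp (-1 * (t : ℂ) ^ 2 + -(2 * z) * t + -z ^ 2) := by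
          congr 1; ext t; congr 1; ring
      _ = _ := by
        rw [this, Real.sqrt_eq_rpow, Complex.ofReal_cpow Real.pi_pos.le,
          show -z ^ 2 - (-(2 * z)) ^ 2 / (4 * -1) = 0 by ring]
        simp
  have hpi : (Real.sqrt Real.pi : ℂ) ≠ 0 := by
    simpa using (Real.sqrt_pos.2 Real.pi_pos).ne'
  unfold cerfc
  rw [← mul_add, h1, add_comm, ← Set.compl_Ioi,
    add_comm, integral_add_compl measurableSet_Ioi (integrable_cexp_neg_add_sq z), h2]
  field_simp

/-- The Gaussian integral produced by the saddle point at the pole. -/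
theorem integral_gaussian_div_sub {lam : ℝ} (hlam : 0 < lam) {w : ℂ} (hw : w.re < 0) :
    ∫ t : ℝ, Complex.exp (-(lam / 2) * (t : ℂ) ^ 2) * (1 / (Complex.I * t - w))
      = Real.pi * Complex.exp (lam * w ^ 2 / 2) * cerfc (-(w * (Real.sqrt (lam / 2) : ℂ))) := by
  have hre : ∀ t : ℝ, (w - Complex.I * t).re < 0 := fun t => by simpa using hw
  -- The pole is written as a Laplace integral, convergent because `Re w < 0`. After Fubini the
  -- `t`-integral is purely Gaussian.
  have h1 : ∀ t : ℝ, 1 / (Complex.I * t - w)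
      = ∫ x in Set.Ioi (0 : ℝ), Complex.exp ((w - Complex.I * t) * x) := fun t => by
    rw [integral_exp_mul_complex_Ioi (hre t)]
    have : w - Complex.I * t ≠ 0 := fun h => by have := hre t; rw [h] at this; simp at this
    have h' : Complex.I * t - w ≠ 0 := fun h => this (by linear_combination -h)
    field_simp
    simp
  set μ := (volume : Measure ℝ).restrict (Set.Ioi 0) with hμ
  have hint : Integrable (Function.uncurry fun (t x : ℝ) =>
      Complex.exp (-(lam / 2) * (t : ℂ) ^ 2) * Complex.exp ((w - Complex.I * t) * x))
      ((volume : Measure ℝ).prod μ) := by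
    have hg : Integrable (fun p : ℝ × ℝ => Real.exp (-(lam / 2) * p.1 ^ 2) * Real.exp (w.re * p.2))
        ((volume : Measure ℝ).prod μ) :=
      (integrable_exp_neg_mul_sq (by positivity : 0 < lam / 2)).mul_prod
        (integrableOn_exp_mul_Ioi hw 0)
    refine hg.mono' (Continuous.aestronglyMeasurable ?_) (Eventually.of_forall ?_)
    · simp only [Function.uncurry_def]; fun_prop
    · rintro ⟨t, x⟩
      simp only [Function.uncurry_apply_pair, norm_mul, Complex.norm_exp]
      apply le_of_eq
      congr 2
      · rw [← Complex.ofReal_pow, ← Complex.ofReal_ofNat, ← Complex.ofReal_div,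
          ← Complex.ofReal_neg, ← Complex.ofReal_mul, Complex.ofReal_re]
      · simp
  have h2 : ∀ x : ℝ, ∫ t : ℝ, Complex.exp (-(lam / 2) * (t : ℂ) ^ 2) *
        Complex.exp ((w - Complex.I * t) * x)
      = (Real.sqrt (2 * Real.pi / lam) : ℂ) * Complex.exp (w * x - x ^ 2 / (2 * lam)) := fun x => by
    have hl : (lam : ℂ) ≠ 0 := by exact_mod_cast hlam.ne'
    have := integral_cexp_quadratic (b := -(lam / 2)) (by simpa using hlam) (-(Complex.I * x)) (w * x)
    calc _ = ∫ t : ℝ, Complex.exp (-(lam / 2) * (t : ℂ) ^ 2 + -(Complex.I * x) * t + w * x) := by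
          congr 1; ext t; rw [← Complex.exp_add]; congr 1; ring
      _ = _ := by
        rw [this, Real.sqrt_eq_rpow, Complex.ofReal_cpow (by positivity)]
        congr 2
        · push_cast; field_simp
        · push_cast; ring
        · have : Complex.I ^ 2 = -1 := Complex.I_sq
          field_simp
          linear_combination (4 * x ^ 2 : ℂ) * this
  have hs : (0 : ℝ) < Real.sqrt (2 * lam) := by positivity
  calc _ = ∫ t : ℝ, ∫ x, Complex.exp (-(lam / 2) * (t : ℂ) ^ 2) *
        Complex.exp ((w - Complex.I * t) * x) ∂μ := by
        refine integral_congr_ae (Eventually.of_forall fun t => ?_)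
        simp only [h1, hμ, integral_const_mul]
    _ = ∫ x : ℝ, (∫ t : ℝ, Complex.exp (-(lam / 2) * (t : ℂ) ^ 2) *
        Complex.exp ((w - Complex.I * t) * x)) ∂μ := integral_integral_swap hint
    _ = (Real.sqrt (2 * Real.pi / lam) : ℂ) *
          ∫ x in Set.Ioi (0 : ℝ), Complex.exp (w * x - x ^ 2 / (2 * lam)) := by
        rw [hμ, ← integral_const_mul]; congr 1; ext x; exact h2 x
    _ = (Real.sqrt (2 * Real.pi / lam) : ℂ) * ((Real.sqrt (2 * lam) : ℂ) *
          ∫ x in Set.Ioi (0 : ℝ), Complex.exp (lam * w ^ 2 / 2) *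
            Complex.exp (-(-(w * (Real.sqrt (lam / 2) : ℂ)) + (x : ℂ)) ^ 2)) := by
        congr 1
        -- Scaling `x` by `√(2λ)` turns the exponent into `λw²/2 - (x - w√(λ/2))²`.
        have := integral_comp_mul_left_Ioi
          (fun x : ℝ => Complex.exp (w * x - x ^ 2 / (2 * lam))) 0 hs
        rw [mul_zero] at this
        have h2s : (Real.sqrt (2 * lam) : ℂ) = 2 * (Real.sqrt (lam / 2) : ℂ) := by
          rw [show 2 * lam = 2 ^ 2 * (lam / 2) by ring, Real.sqrt_mul (by norm_num),
            Real.sqrt_sq (by norm_num)]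
          push_cast; ring
        have hsq : (Real.sqrt (lam / 2) : ℂ) ^ 2 = lam / 2 := by
          rw [← Complex.ofReal_pow, Real.sq_sqrt (by positivity)]; push_cast; ring
        have hl : (lam : ℂ) ≠ 0 := by exact_mod_cast hlam.ne'
        rw [← Complex.real_smul, ← inv_smul_eq_iff₀ hs.ne', ← this]
        refine integral_congr_ae (Eventually.of_forall fun x => ?_)
        simp only [← Complex.exp_add]
        congr 1
        push_cast
        rw [h2s]
        field_simp
        linear_combination (-4 * x ^ 2 + 2 * lam * w ^ 2 : ℂ) * hsq
    _ = _ := by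
        rw [integral_const_mul, cerfc]
        have h3 : (Real.sqrt (2 * Real.pi / lam) : ℂ) * (Real.sqrt (2 * lam) : ℂ)
            = 2 * (Real.sqrt Real.pi : ℂ) := by
          rw [← Complex.ofReal_mul, ← Real.sqrt_mul (by positivity),
            show 2 * Real.pi / lam * (2 * lam) = 2 ^ 2 * Real.pi by field_simp,
            Real.sqrt_mul (by norm_num), Real.sqrt_sq (by norm_num)]
          push_cast; ring
        have h4 : (Real.pi : ℂ) = (Real.sqrt Real.pi : ℂ) * (Real.sqrt Real.pi : ℂ) := by
          rw [← Complex.ofReal_mul, Real.mul_self_sqrt Real.pi_pos.le]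
        have hpi : (Real.sqrt Real.pi : ℂ) ≠ 0 := by
          simpa using (Real.sqrt_pos.2 Real.pi_pos).ne'
        rw [← mul_assoc, h3, h4]
        field_simp

end ErrorFunction
-- Cauchy integral for the Taylor remainder
section Remainder

open MeasureTheory

/-- The Cauchy kernel `1/(s - z)` is expanded as a geometric sum of `n` terms plus an exact
remainder; the terms integrate to the Taylor polynomial. -/
theorem sub_maclaurinSum_eq_circleIntegral {f : ℂ → ℂ} (hf : Differentiable ℂ f) {n : ℕ}
    (hn : 0 < n) {R : ℝ} {z : ℂ} (hz : ‖z‖ < R) :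
    f z - maclaurinSum f (n - 1) z
      = (2 * Real.pi * Complex.I)⁻¹ * (z ^ n * ∮ s in C(0, R), f s / (s ^ n * (s - z))) := by
  have hR : 0 < R := (norm_nonneg z).trans_lt hz
  have hs0 : ∀ s ∈ Metric.sphere (0 : ℂ) R, s ≠ 0 := fun s hs h => by simp [h] at hs; exact hR.ne hs
  have hsz : ∀ s ∈ Metric.sphere (0 : ℂ) R, s - z ≠ 0 := fun s hs h => by
    rw [sub_eq_zero.1 h] at hs; simp at hs; exact hz.ne hs
  have hpi : (2 * Real.pi * Complex.I : ℂ) ≠ 0 := Complex.two_pi_I_ne_zero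
  have h1 : (∮ s in C(0, R), (s - z)⁻¹ • f s) = (2 * Real.pi * Complex.I : ℂ) • f z :=
    hf.diffContOnCl.circleIntegral_sub_inv_smul (by simpa using hz)
  have h2 : ∀ k : ℕ, ∮ s in C(0, R), (1 / (s - 0) ^ (k + 1)) • f s
      = (2 * Real.pi * Complex.I / k.factorial) • iteratedDeriv k f 0 := fun k =>
    hf.diffContOnCl.circleIntegral_one_div_sub_center_pow_smul hR k
  have hc1 : ∀ k ∈ Finset.range n,
      CircleIntegrable (fun s => z ^ k * ((1 / (s - 0) ^ (k + 1)) • f s)) 0 R := fun k _ => by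
    refine ContinuousOn.circleIntegrable hR.le ?_
    simp only [smul_eq_mul]
    refine continuousOn_const.mul (ContinuousOn.mul ?_ hf.continuous.continuousOn)
    exact continuousOn_const.div (by fun_prop) fun s hs => by simpa using fun h => hs0 s hs h
  have hc2 : CircleIntegrable (fun s => z ^ n * (f s / (s ^ n * (s - z)))) 0 R := by
    refine ContinuousOn.circleIntegrable hR.le ?_
    refine continuousOn_const.mul (hf.continuous.continuousOn.div (by fun_prop) fun s hs => ?_)
    exact mul_ne_zero (pow_ne_zero _ (hs0 s hs)) (hsz s hs)
  have h3 : (∮ s in C(0, R), (s - z)⁻¹ • f s)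
      = ∮ s in C(0, R), ((∑ k ∈ Finset.range n, z ^ k * ((1 / (s - 0) ^ (k + 1)) • f s))
        + z ^ n * (f s / (s ^ n * (s - z)))) := by
    refine circleIntegral.integral_congr hR.le fun s hs => ?_
    have hs := (⟨hs0 s hs, hsz s hs⟩ : s ≠ 0 ∧ s - z ≠ 0)
    obtain ⟨hs1, hs2⟩ := hs
    have hgeom : ∀ n : ℕ, (s - z)⁻¹
        = (∑ k ∈ Finset.range n, z ^ k * (1 / s ^ (k + 1))) + z ^ n / (s ^ n * (s - z)) := by
      intro n
      induction n with
      | zero => simp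
      | succ n ih => rw [ih, Finset.sum_range_succ]; field_simp; ring
    simp only [smul_eq_mul, sub_zero]
    rw [hgeom n, add_mul, Finset.sum_mul]
    congr 1
    · exact Finset.sum_congr rfl fun k _ => by ring
    · ring
  rw [circleIntegral.integral_add (CircleIntegrable.fun_sum _ hc1) hc2,
    circleIntegral.integral_fun_sum hc1, circleIntegral.integral_const_mul, h1] at h3
  simp_rw [circleIntegral.integral_const_mul, h2] at h3
  have h4 : ∑ k ∈ Finset.range n,
      z ^ k * ((2 * Real.pi * Complex.I / k.factorial) • iteratedDeriv k f 0)
      = (2 * Real.pi * Complex.I) * maclaurinSum f (n - 1) z := by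
    -- `hn` is needed here: at `n = 0` the truncated subtraction would leave the constant term in
    -- the partial sum.
    rw [maclaurinSum, Nat.sub_add_cancel hn, Finset.mul_sum]
    exact Finset.sum_congr rfl fun k _ => by simp only [smul_eq_mul]; ring
  rw [h4, smul_eq_mul] at h3
  rw [eq_inv_mul_iff_mul_eq₀ hpi]
  linear_combination h3

theorem sub_maclaurinSum_eq_integral {f : ℂ → ℂ} (hf : Differentiable ℂ f) {n : ℕ}
    (hn : 0 < n) {r : ℝ} (hr : 0 < r) {q : ℂ} (hq : ‖q‖ < 1) :
    f (r * q) - maclaurinSum f (n - 1) (r * q)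
      = q ^ n / (2 * Real.pi) * ∫ φ in (-Real.pi)..Real.pi,
          f (r * Complex.exp (φ * Complex.I)) / (Complex.exp (φ * Complex.I)) ^ n /
            (1 - q / Complex.exp (φ * Complex.I)) := by
  have hz : ‖(r : ℂ) * q‖ < r := by
    rw [norm_mul, Complex.norm_real, Real.norm_of_nonneg hr.le]; nlinarith
  have hr' : (r : ℂ) ≠ 0 := by exact_mod_cast hr.ne'
  have hpi : (Real.pi : ℂ) ≠ 0 := by exact_mod_cast Real.pi_ne_zero
  rw [sub_maclaurinSum_eq_circleIntegral hf hn hz, circleIntegral]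
  set g : ℝ → ℂ := fun φ => f (r * Complex.exp (φ * Complex.I)) / (Complex.exp (φ * Complex.I)) ^ n /
            (1 - q / Complex.exp (φ * Complex.I)) with hg
  have hper : Function.Periodic g (2 * Real.pi) := fun φ => by
    have : Complex.exp (((φ + 2 * Real.pi : ℝ) : ℂ) * Complex.I) = Complex.exp (φ * Complex.I) := by
      push_cast; rw [add_mul]; exact Complex.exp_periodic _
    simp only [hg, this]
  have hI : ∫ φ in (-Real.pi)..Real.pi, g φ = ∫ φ in (0 : ℝ)..(2 * Real.pi), g φ := by
    have := hper.intervalIntegral_add_eq (-Real.pi) 0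
    rwa [zero_add, show -Real.pi + 2 * Real.pi = Real.pi by ring] at this
  rw [hI]
  have hh : ∀ φ : ℝ, deriv (circleMap 0 r) φ • (f (circleMap 0 r φ) /
      (circleMap 0 r φ ^ n * (circleMap 0 r φ - r * q))) = Complex.I / r ^ n * g φ := fun φ => by
    have he : Complex.exp (φ * Complex.I) ≠ 0 := Complex.exp_ne_zero _
    have hq' : Complex.exp (φ * Complex.I) - q ≠ 0 := fun h => by
      rw [← sub_eq_zero.1 h, Complex.norm_exp_ofReal_mul_I] at hq
      exact lt_irrefl _ hq
    simp only [deriv_circleMap, hg, circleMap, zero_add, smul_eq_mul]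
    rw [one_sub_div he, ← mul_sub, mul_pow]
    field_simp
  simp_rw [hh, intervalIntegral.integral_const_mul, mul_pow]
  field_simp

end Remainder

/-! ### Splitting the circle into arcs -/

section Sectors

open MeasureTheory

theorem arg_exp_of_mem_Ioc {v : ℂ} (h1 : -Real.pi < v.im) (h2 : v.im ≤ Real.pi) :
    (Complex.exp v).arg = v.im := by
  rw [← Complex.log_im, Complex.log_exp h1 h2]

theorem mul_exp_mem_closedSector_iff {ζ : ℂ} (hζ : ζ ≠ 0) {ε : ℝ} {v : ℂ} (h1 : -Real.pi < v.im)
    (h2 : v.im ≤ Real.pi) : ζ * Complex.exp v ∈ closedSector ζ ε ↔ |v.im| ≤ ε := by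
  have : ζ * Complex.exp v ≠ 0 := mul_ne_zero hζ (Complex.exp_ne_zero _)
  simp only [closedSector, Set.mem_ofPred_eq, this, ne_eq, not_false_eq_true, true_and]
  rw [mul_div_cancel_left₀ _ hζ, arg_exp_of_mem_Ioc h1 h2]

theorem measurableSet_closedSector (ζ : ℂ) (ε : ℝ) : MeasurableSet (closedSector ζ ε) := by
  have h1 : MeasurableSet {z : ℂ | z ≠ 0} := (measurableSet_singleton 0).compl
  have h2 : Measurable fun z : ℂ => |(z / ζ).arg| :=
    (Complex.measurable_arg.comp (measurable_id.div_const ζ)).abs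
  exact h1.inter (h2 measurableSet_Iic)

theorem periodic_comp_exp_mul_I {E : Type*} (g : ℂ → E) :
    Function.Periodic (fun φ : ℝ => g (Complex.exp (φ * Complex.I))) (2 * Real.pi) := fun φ => by
  have : Complex.exp (((φ + 2 * Real.pi : ℝ) : ℂ) * Complex.I) = Complex.exp (φ * Complex.I) := by
    push_cast; rw [add_mul]; exact Complex.exp_periodic _
  simp only [this]

theorem integral_indicator_closedSector {ζ : ℂ} (hζ : ‖ζ‖ = 1) {ε : ℝ} (hε : 0 < ε)
    (hεπ : ε < Real.pi) (g : ℂ → ℂ) :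
    ∫ φ in (-Real.pi)..Real.pi, (closedSector ζ ε).indicator g (Complex.exp (φ * Complex.I))
      = ∫ φ in (-ε)..ε, g (ζ * Complex.exp (φ * Complex.I)) := by
  have hζ0 : ζ ≠ 0 := fun h => by simp [h] at hζ
  have hζe : ζ = Complex.exp (ζ.arg * Complex.I) := by
    have := Complex.norm_mul_exp_arg_mul_I ζ
    rw [hζ] at this; simpa using this.symm
  -- By periodicity the window of integration is centred at `arg ζ`, so the arc lies in its interior
  -- and does not wrap around.
  have hper := periodic_comp_exp_mul_I ((closedSector ζ ε).indicator g)
  have h1 := hper.intervalIntegral_add_eq (-Real.pi) (-Real.pi + ζ.arg)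
  rw [show -Real.pi + 2 * Real.pi = Real.pi by ring,
    show -Real.pi + ζ.arg + 2 * Real.pi = Real.pi + ζ.arg by ring,
    ← intervalIntegral.integral_comp_add_right] at h1
  rw [h1]
  have h2 : ∀ φ ∈ Set.Ioc (-Real.pi) Real.pi,
      (closedSector ζ ε).indicator g (Complex.exp ((φ + ζ.arg : ℝ) * Complex.I))
      = (Set.Icc (-ε) ε).indicator (fun φ : ℝ => g (ζ * Complex.exp (φ * Complex.I))) φ := by
    intro φ hφ
    have he : Complex.exp ((φ + ζ.arg : ℝ) * Complex.I) = ζ * Complex.exp (φ * Complex.I) := by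
      conv_rhs => rw [hζe]
      rw [← Complex.exp_add]; congr 1; push_cast; ring
    have hiff := mul_exp_mem_closedSector_iff hζ0 (ε := ε) (v := φ * Complex.I) (by simpa using hφ.1)
      (by simpa using hφ.2)
    simp only [Complex.im_ofReal_mul, Complex.I_im, mul_one] at hiff
    rw [he]
    by_cases hm : |φ| ≤ ε
    · rw [Set.indicator_of_mem (hiff.2 hm), Set.indicator_of_mem (show φ ∈ Set.Icc (-ε) ε from abs_le.1 hm)]
    · rw [Set.indicator_of_notMem (fun h => hm (hiff.1 h)),
        Set.indicator_of_notMem (s := Set.Icc (-ε) ε) (fun h => hm (abs_le.2 h))]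
  have hsub : Set.Icc (-ε) ε ⊆ Set.Ioc (-Real.pi) Real.pi :=
    fun x hx => ⟨by linarith [hx.1], by linarith [hx.2]⟩
  rw [intervalIntegral.integral_of_le (by linarith [Real.pi_pos]),
    setIntegral_congr_fun measurableSet_Ioc h2, setIntegral_indicator measurableSet_Icc,
    Set.inter_eq_right.2 hsub,
    integral_Icc_eq_integral_Ioc, ← intervalIntegral.integral_of_le (by linarith)]

/-- A circle integral splits into integrals over disjoint arcs and over the remaining set. -/
theorem integral_circle_eq_sum_sectors {ι : Type*} [Fintype ι] {ζ : ι → ℂ}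
    (hζ : ∀ i, ‖ζ i‖ = 1) {ε : ℝ} (hε : 0 < ε) (hεπ : ε < Real.pi)
    (hdisj : ∀ i j, i ≠ j → Disjoint (closedSector (ζ i) ε) (closedSector (ζ j) ε))
    {g : ℂ → ℂ} (hg : Continuous fun φ : ℝ => g (Complex.exp (φ * Complex.I))) :
    ∫ φ in (-Real.pi)..Real.pi, g (Complex.exp (φ * Complex.I))
      = (∑ i, ∫ φ in (-ε)..ε, g (ζ i * Complex.exp (φ * Complex.I)))
        + ∫ φ in (-Real.pi)..Real.pi,
            (⋃ i, closedSector (ζ i) ε)ᶜ.indicator g (Complex.exp (φ * Complex.I)) := by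
  have hm : Measurable fun φ : ℝ => Complex.exp (φ * Complex.I) :=
    Continuous.measurable (by fun_prop)
  have hint : ∀ S : Set ℂ, MeasurableSet S → IntervalIntegrable
      (fun φ : ℝ => S.indicator g (Complex.exp (φ * Complex.I))) volume (-Real.pi) Real.pi := by
    intro S hS
    have := (hg.intervalIntegrable (μ := volume) (-Real.pi) Real.pi)
    rw [intervalIntegrable_iff] at this ⊢
    exact this.indicator (hm hS)
  have hpt : ∀ z, g z = (∑ i, (closedSector (ζ i) ε).indicator g z)
      + (⋃ i, closedSector (ζ i) ε)ᶜ.indicator g z := by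
    intro z
    by_cases hz : z ∈ ⋃ i, closedSector (ζ i) ε
    · obtain ⟨i, hi⟩ := Set.mem_iUnion.1 hz
      rw [Set.indicator_of_notMem (by simpa using ⟨i, hi⟩), add_zero, Finset.sum_eq_single i,
        Set.indicator_of_mem hi]
      · intro j _ hj
        exact Set.indicator_of_notMem (fun h => (hdisj j i hj).le_bot ⟨h, hi⟩) _
      · simp
    · rw [Set.indicator_of_mem hz, Finset.sum_eq_zero, zero_add]
      exact fun i _ => Set.indicator_of_notMem (fun h => hz (Set.mem_iUnion.2 ⟨i, h⟩)) _
  simp_rw [← fun i => integral_indicator_closedSector (hζ i) hε hεπ g]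
  rw [← intervalIntegral.integral_finsetSum
      (fun i _ => hint _ (measurableSet_closedSector _ _)),
    ← intervalIntegral.integral_add]
  · exact intervalIntegral.integral_congr fun φ _ => hpt _
  · have := IntervalIntegrable.sum Finset.univ fun i _ => hint _ (measurableSet_closedSector (ζ i) ε)
    simpa only [Finset.sum_fn] using this
  · exact hint _ (MeasurableSet.iUnion fun i => measurableSet_closedSector _ _).compl

end Sectors

/-! ### Oscillating sums with slowly varying amplitudes -/

section SlowVariation

/-- Slowly varying sequences carried by distinct characters cannot cancel. -/
theorem tendsto_zero_of_sum_characters {ι : Type*} (s : Finset ι) {ζ : ι → ℂ}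
    (hζ : ∀ i ∈ s, ‖ζ i‖ = 1) (hinj : ∀ i ∈ s, ∀ j ∈ s, i ≠ j → ζ i ≠ ζ j) :
    ∀ x : ι → ℕ → ℂ, (∀ i ∈ s, Tendsto (fun n => x i (n + 1) - x i n) atTop (𝓝 0)) →
    Tendsto (fun n => ∑ i ∈ s, (ζ i)⁻¹ ^ n * x i n) atTop (𝓝 0) →
    ∀ i ∈ s, Tendsto (x i) atTop (𝓝 0) := by
  classical
  induction s using Finset.induction_on with
  | empty => simp
  | insert o s ho ih =>
    intro x hx hsum
    have hne : ∀ i ∈ insert o s, ζ i ≠ 0 := fun i hi h => by simpa [h] using hζ i hi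
    have hpow : ∀ i ∈ insert o s, ∀ u : ℕ → ℂ, Tendsto (fun n => (ζ i)⁻¹ ^ n * u n) atTop (𝓝 0) ↔
        Tendsto u atTop (𝓝 0) := fun i hi u => by
      rw [tendsto_zero_iff_norm_tendsto_zero, tendsto_zero_iff_norm_tendsto_zero (f := u)]
      simp [hζ i hi]
    have hoi := Finset.mem_insert_self o s
    -- Shifting `n` by one, multiplying by `ζ o` and subtracting the original sum annihilates the
    -- `o`-term up to an increment of `x o`. Every other term acquires the nonzero factor `ζ o / ζ i
    -- - 1`, again up to an increment, so the induction hypothesis applies to the remaining indices.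
    have hs : ∀ i ∈ s, Tendsto (x i) atTop (𝓝 0) := by
      have key := ih (fun i hi => hζ i (Finset.mem_insert_of_mem hi))
        (fun i hi j hj => hinj i (Finset.mem_insert_of_mem hi) j (Finset.mem_insert_of_mem hj))
        (fun i n => (ζ o * (ζ i)⁻¹ - 1) * x i n) ?_ ?_
      · intro i hi
        have hc : ζ o * (ζ i)⁻¹ - 1 ≠ 0 := fun h => by
          have h0 := hne i (Finset.mem_insert_of_mem hi)
          have : ζ o = ζ i := by
            field_simp at h
            linear_combination h
          exact hinj o hoi i (Finset.mem_insert_of_mem hi) (fun e => ho (e ▸ hi)) this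
        have := (key i hi).const_mul (ζ o * (ζ i)⁻¹ - 1)⁻¹
        simpa [hc] using this
      · intro i hi
        have := (hx i (Finset.mem_insert_of_mem hi)).const_mul (ζ o * (ζ i)⁻¹ - 1)
        simpa [mul_sub] using this
      · have h1 := ((hsum.comp (tendsto_add_atTop_nat 1)).const_mul (ζ o)).sub hsum
        have h2 : ∀ i ∈ insert o s, Tendsto (fun n => (ζ i)⁻¹ ^ n *
            (ζ o * (ζ i)⁻¹ * (x i (n + 1) - x i n))) atTop (𝓝 0) := fun i hi => by
          rw [hpow i hi]
          simpa using (hx i hi).const_mul (ζ o * (ζ i)⁻¹)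
        have h3 := h1.sub (tendsto_finsetSum _ h2)
        simp only [mul_zero, sub_zero, Finset.sum_const_zero] at h3
        refine h3.congr fun n => ?_
        have h0 := hne o hoi
        rw [Function.comp_apply, Finset.mul_sum, ← Finset.sum_sub_distrib, ← Finset.sum_sub_distrib,
          Finset.sum_insert ho]
        have hz : ζ o * ((ζ o)⁻¹ ^ (n + 1) * x o (n + 1)) - (ζ o)⁻¹ ^ n * x o n -
            (ζ o)⁻¹ ^ n * (ζ o * (ζ o)⁻¹ * (x o (n + 1) - x o n)) = 0 := by
          rw [mul_inv_cancel₀ h0, pow_succ]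
          linear_combination ((ζ o)⁻¹ ^ n * x o (n + 1)) * (mul_inv_cancel₀ h0)
        rw [hz, zero_add]
        exact Finset.sum_congr rfl fun i _ => by ring
    intro i hi
    rcases Finset.mem_insert.1 hi with rfl | hi
    · rw [← hpow i hoi]
      have h4 := hsum.sub (tendsto_finsetSum s fun j hj =>
        (hpow j (Finset.mem_insert_of_mem hj) _).2 (hs j hj))
      simp only [Finset.sum_const_zero, sub_zero] at h4
      refine h4.congr fun n => ?_
      rw [Finset.sum_insert ho]; ring
    · exact hs i hi

/-- The ratio of consecutive terms tends to 1 and the terms are bounded. The boundary case of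
imaginary `β` matters: the sequence then need not converge, but it turns ever more slowly. -/
theorem tendsto_natCast_cpow_succ_sub {β : ℂ} (hβ : β.re ≤ 0) :
    Tendsto (fun n : ℕ => ((n + 1 : ℕ) : ℂ) ^ β - (n : ℂ) ^ β) atTop (𝓝 0) := by
  have h1 : Tendsto (fun n : ℕ => (((n + 1 : ℕ) : ℝ) / n : ℂ) ^ β - 1) atTop (𝓝 0) := by
    have h2 : Tendsto (fun n : ℕ => ((((n + 1 : ℕ) : ℝ) / n : ℝ) : ℂ)) atTop (𝓝 ((1 : ℝ) : ℂ)) := by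
      refine (Complex.continuous_ofReal.tendsto 1).comp ?_
      have := (tendsto_one_div_atTop_nhds_zero_nat (𝕜 := ℝ)).const_add 1
      rw [add_zero] at this
      refine this.congr' ?_
      filter_upwards [eventually_gt_atTop 0] with n hn
      have : (n : ℝ) ≠ 0 := by exact_mod_cast hn.ne'
      field_simp; push_cast; ring
    have h3 := (h2.cpow (tendsto_const_nhds (x := β))
      (by simp [Complex.mem_slitPlane_iff])).sub_const 1
    simpa using h3
  refine squeeze_zero_norm' (a := fun n : ℕ => ‖(((n + 1 : ℕ) : ℝ) / n : ℂ) ^ β - 1‖) ?_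
    (tendsto_zero_iff_norm_tendsto_zero.1 h1)
  filter_upwards [eventually_gt_atTop 0] with n hn
  have hn' : (0 : ℝ) < n := by exact_mod_cast hn
  have h4 : ((n + 1 : ℕ) : ℂ) ^ β = (n : ℂ) ^ β * (((n + 1 : ℕ) : ℝ) / n : ℂ) ^ β := by
    rw [← Complex.ofReal_natCast n, ← Complex.ofReal_div,
      ← Complex.mul_cpow_ofReal_nonneg (by positivity) (by positivity), ← Complex.ofReal_mul]
    congr 1
    rw [mul_div_cancel₀ _ hn'.ne']; simp
  rw [h4, ← mul_sub_one, norm_mul]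
  have h5 : ‖(n : ℂ) ^ β‖ ≤ 1 := by
    rw [← Complex.ofReal_natCast, Complex.norm_cpow_eq_rpow_re_of_pos hn']
    exact Real.rpow_le_one_of_one_le_of_nonpos (by exact_mod_cast hn) hβ
  exact mul_le_of_le_one_left (norm_nonneg _) h5

/-- If oscillating power terms with nonvanishing slowly varying amplitudes sum to a null sequence,
then every exponent has negative real part. -/
theorem re_neg_of_tendsto_sum_characters {ι : Type*} [Fintype ι] {ζ β c : ι → ℂ}
    (hζ : ∀ i, ‖ζ i‖ = 1) (hinj : ∀ i j, i ≠ j → ζ i ≠ ζ j) (hc : ∀ i, c i ≠ 0)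
    {J : ι → ℕ → ℂ} (hJ : ∀ i, Tendsto (J i) atTop (𝓝 (c i)))
    (hsum : Tendsto (fun n : ℕ => ∑ i, (ζ i)⁻¹ ^ n * ((n : ℂ) ^ β i * J i n)) atTop (𝓝 0)) (i : ι) :
    (β i).re < 0 := by
  obtain ⟨m, -, hm⟩ := Finset.exists_max_image Finset.univ (fun i => (β i).re) ⟨i, Finset.mem_univ i⟩
  refine (hm i (Finset.mem_univ i)).trans_lt ?_
  -- Suppose the largest real part `σ` is nonnegative. Dividing by `n^σ` keeps the sum null and
  -- makes all amplitudes bounded and slowly varying, while the amplitude of the maximal index `m`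
  -- keeps the nonzero limiting modulus `‖c m‖`.
  by_contra! h
  set σ : ℂ := ((β m).re : ℂ)
  have hpos : ∀ᶠ n : ℕ in atTop, 0 < (n : ℝ) := by
    filter_upwards [eventually_gt_atTop 0] with n hn; exact_mod_cast hn
  have hre : ∀ j, (β j - σ).re ≤ 0 := fun j => by
    simpa [σ] using hm j (Finset.mem_univ j)
  have hbd : ∀ j, ∀ᶠ n : ℕ in atTop, ‖(n : ℂ) ^ (β j - σ)‖ ≤ 1 := fun j => by
    filter_upwards [eventually_gt_atTop 0] with n hn
    rw [← Complex.ofReal_natCast, Complex.norm_cpow_eq_rpow_re_of_pos (by exact_mod_cast hn)]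
    exact Real.rpow_le_one_of_one_le_of_nonpos (by exact_mod_cast hn) (hre j)
  have hx := tendsto_zero_of_sum_characters Finset.univ (fun i _ => hζ i) (fun i _ j _ => hinj i j)
    (fun i n => (n : ℂ) ^ (β i - σ) * J i n) ?_ ?_ m (Finset.mem_univ m)
  · have h1 : Tendsto (fun n => ‖J m n‖) atTop (𝓝 0) := by
      refine (tendsto_zero_iff_norm_tendsto_zero.1 hx).congr' ?_
      filter_upwards [hpos] with n hn
      rw [norm_mul, ← Complex.ofReal_natCast, Complex.norm_cpow_eq_rpow_re_of_pos hn]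
      simp [σ]
    exact hc m (norm_eq_zero.1 (tendsto_nhds_unique (hJ m).norm h1))
  · intro j _
    have hJ1 : Tendsto (fun n => J j (n + 1)) atTop (𝓝 (c j)) :=
      (hJ j).comp (tendsto_add_atTop_nat 1)
    have h1 := (tendsto_natCast_cpow_succ_sub (hre j)).mul hJ1
    have h2 : Tendsto (fun n : ℕ => (n : ℂ) ^ (β j - σ) * (J j (n + 1) - J j n)) atTop (𝓝 0) := by
      have h3 : Tendsto (fun n => ‖J j (n + 1) - J j n‖) atTop (𝓝 0) := by
        simpa using (hJ1.sub (hJ j)).norm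
      refine squeeze_zero_norm' ?_ h3
      filter_upwards [hbd j] with n hn
      rw [norm_mul]
      exact mul_le_of_le_one_left (norm_nonneg _) hn
    have h4 := h1.add h2
    rw [zero_mul, zero_add] at h4
    exact h4.congr fun n => by ring
  · refine squeeze_zero_norm' ?_ (tendsto_zero_iff_norm_tendsto_zero.1 hsum)
    filter_upwards [eventually_gt_atTop 0] with n hn
    have hn0 : (n : ℂ) ≠ 0 := by exact_mod_cast hn.ne'
    have h1 : ∑ i, (ζ i)⁻¹ ^ n * ((n : ℂ) ^ β i * J i n)
        = (n : ℂ) ^ σ * ∑ i, (ζ i)⁻¹ ^ n * ((n : ℂ) ^ (β i - σ) * J i n) := by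
      rw [Finset.mul_sum]
      refine Finset.sum_congr rfl fun i _ => ?_
      conv_lhs => rw [← sub_add_cancel (β i) σ, Complex.cpow_add _ _ hn0]
      ring
    rw [h1, norm_mul, ← Complex.ofReal_natCast,
      Complex.norm_cpow_eq_rpow_re_of_pos (by exact_mod_cast hn)]
    exact le_mul_of_one_le_left (norm_nonneg _)
      (Real.one_le_rpow (by exact_mod_cast hn) (by simpa [σ] using h))

end SlowVariation

/-! ### Laplace's method at a saddle point -/

section Saddle

open MeasureTheory

/-- The horizontal half-strip filter: `Re v → ∞` within `|Im v| ≤ ε`. -/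
def stripFilter (ε : ℝ) : Filter ℂ :=
  comap Complex.re atTop ⊓ 𝓟 {v | |v.im| ≤ ε}

/-- The logarithm of the scaling radius. -/
def logRadius (lam : ℝ) (n : ℕ) : ℝ :=
  Real.log (n / lam) / lam

/-- The values of `f` near the saddle point `ζ * r_n`, divided by their exponential size. -/
def saddleQuotient (f : ℂ → ℂ) (lam : ℝ) (b ζ : ℂ) (n : ℕ) (u : ℂ) : ℂ :=
  f (ζ * Complex.exp (logRadius lam n + u / (Real.sqrt n : ℂ))) /
    Complex.exp (b * logRadius lam n + n / lam + (Real.sqrt n : ℂ) * u)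

theorem exp_logRadius {lam : ℝ} (hlam : 0 < lam) {n : ℕ} (hn : 0 < n) :
    Real.exp (logRadius lam n) = scalingRadius lam n := by
  have : (0 : ℝ) < n / lam := div_pos (by exact_mod_cast hn) hlam
  rw [scalingRadius, Real.rpow_def_of_pos this, logRadius, mul_one_div]

theorem cexp_lam_mul_logRadius {lam : ℝ} (hlam : 0 < lam) {n : ℕ} (hn : 0 < n) :
    Complex.exp (lam * logRadius lam n) = n / lam := by
  have : (0 : ℝ) < n / lam := div_pos (by exact_mod_cast hn) hlam
  rw [logRadius, ← Complex.ofReal_mul, mul_div_cancel₀ _ hlam.ne', ← Complex.ofReal_exp,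
    Real.exp_log this]
  push_cast; rfl

theorem tendsto_logRadius {lam : ℝ} (hlam : 0 < lam) : Tendsto (logRadius lam) atTop atTop := by
  unfold logRadius
  exact (Real.tendsto_log_atTop.comp
    (tendsto_natCast_atTop_atTop.atTop_div_const hlam)).atTop_div_const hlam

theorem tendsto_sqrt_natCast : Tendsto (fun n : ℕ => Real.sqrt n) atTop atTop :=
  Real.tendsto_sqrt_atTop.comp tendsto_natCast_atTop_atTop

/-- The difference between the exponents of the growth model at a scaled point and at the saddle
point. -/
theorem saddle_exponent {lam : ℝ} (hlam : 0 < lam) (b : ℂ) {n : ℕ} (hn : 0 < n) (u : ℂ) :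
    b * (logRadius lam n + u / (Real.sqrt n : ℂ)) +
        Complex.exp (lam * (logRadius lam n + u / (Real.sqrt n : ℂ)))
      = (b * logRadius lam n + n / lam + (Real.sqrt n : ℂ) * u) + (b * (u / (Real.sqrt n : ℂ)) +
        n / lam * (Complex.exp (lam * u / (Real.sqrt n : ℂ)) - 1 - lam * u / (Real.sqrt n : ℂ))) := by
  have hs : (0 : ℝ) < Real.sqrt n := Real.sqrt_pos.2 (by exact_mod_cast hn)
  have hs0 : (Real.sqrt n : ℂ) ≠ 0 := by exact_mod_cast hs.ne'
  have hsq : (n : ℂ) = (Real.sqrt n : ℂ) * (Real.sqrt n : ℂ) := by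
    rw [← Complex.ofReal_mul, Real.mul_self_sqrt (by positivity)]; simp
  have hl : (lam : ℂ) ≠ 0 := by exact_mod_cast hlam.ne'
  rw [mul_add (lam : ℂ), Complex.exp_add, cexp_lam_mul_logRadius hlam hn, ← mul_div_assoc]
  have h : (n : ℂ) / lam * (lam * u / (Real.sqrt n : ℂ)) = (Real.sqrt n : ℂ) * u := by
    rw [hsq]; field_simp
  linear_combination h

theorem saddleQuotient_eq {f : ℂ → ℂ} {lam : ℝ} (hlam : 0 < lam) (b ζ : ℂ) {n : ℕ} (hn : 0 < n)
    (u : ℂ) :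
    saddleQuotient f lam b ζ n u
      = (fun v => f (ζ * Complex.exp v) / Complex.exp (b * v + Complex.exp (lam * v)))
          (logRadius lam n + u / (Real.sqrt n : ℂ)) *
        Complex.exp (b * (u / (Real.sqrt n : ℂ)) + n / lam *
          (Complex.exp (lam * u / (Real.sqrt n : ℂ)) - 1 - lam * u / (Real.sqrt n : ℂ))) := by
  have hne := Complex.exp_ne_zero (b * (u / (Real.sqrt n : ℂ)) + n / lam *
          (Complex.exp (lam * u / (Real.sqrt n : ℂ)) - 1 - lam * u / (Real.sqrt n : ℂ)))
  simp only [saddleQuotient]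
  rw [saddle_exponent hlam b hn u, Complex.exp_add (_ + _ + _)]
  field_simp

variable {X : Type*} {l : Filter X} {n : X → ℕ}

theorem tendsto_div_sqrt (hn : Tendsto n l atTop) {u : X → ℂ} {u₀ : ℂ} (hu : Tendsto u l (𝓝 u₀)) :
    Tendsto (fun x => u x / (Real.sqrt (n x) : ℂ)) l (𝓝 0) := by
  have h : Tendsto (fun x => ((Real.sqrt (n x))⁻¹ : ℝ)) l (𝓝 0) :=
    tendsto_inv_atTop_zero.comp (tendsto_sqrt_natCast.comp hn)
  have h2 := hu.mul ((Complex.continuous_ofReal.tendsto 0).comp h)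
  simpa [div_eq_mul_inv, Function.comp_def] using h2

/-- Second-order Taylor expansion of the exponential: the cubic remainder is of order `n ·
n^{-3/2}`. -/
theorem tendsto_gaussian_exponent {lam : ℝ} (hlam : 0 < lam) (hn : Tendsto n l atTop) {u : X → ℂ}
    {u₀ : ℂ} (hu : Tendsto u l (𝓝 u₀)) :
    Tendsto (fun x => (n x : ℂ) / lam * (Complex.exp (lam * u x / (Real.sqrt (n x) : ℂ)) - 1 -
      lam * u x / (Real.sqrt (n x) : ℂ))) l (𝓝 (lam * u₀ ^ 2 / 2)) := by
  have hlu := hu.const_mul (lam : ℂ)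
  have hy := tendsto_div_sqrt hn hlu
  have hl : (lam : ℂ) ≠ 0 := by exact_mod_cast hlam.ne'
  have h1 : Tendsto (fun x => (lam : ℂ) * u x ^ 2 / 2) l (𝓝 (lam * u₀ ^ 2 / 2)) :=
    ((hu.pow 2).const_mul _).div_const _
  rw [← add_zero ((lam : ℂ) * u₀ ^ 2 / 2)]
  have h2 : Tendsto (fun x => (n x : ℂ) / lam * (Complex.exp (lam * u x / (Real.sqrt (n x) : ℂ)) - 1 -
      lam * u x / (Real.sqrt (n x) : ℂ)) - lam * u x ^ 2 / 2) l (𝓝 0) := by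
    have h3 : Tendsto (fun x => ‖(lam : ℂ) * u x‖ ^ 2 / lam * ‖lam * u x / (Real.sqrt (n x) : ℂ)‖)
        l (𝓝 (‖(lam : ℂ) * u₀‖ ^ 2 / lam * ‖(0 : ℂ)‖)) :=
      ((hlu.norm.pow 2).div_const lam).mul hy.norm
    rw [norm_zero, mul_zero] at h3
    refine squeeze_zero_norm' ?_ h3
    have hsmall : ∀ᶠ x in l, ‖lam * u x / (Real.sqrt (n x) : ℂ)‖ ≤ 1 := by
      have := hy.norm
      rw [norm_zero] at this
      exact this.eventually_le_const one_pos
    filter_upwards [hsmall, hn.eventually_gt_atTop 0] with x hx hnx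
    have hs : (0 : ℝ) < Real.sqrt (n x) := Real.sqrt_pos.2 (by exact_mod_cast hnx)
    have hs0 : (Real.sqrt (n x) : ℂ) ≠ 0 := by exact_mod_cast hs.ne'
    have hsq : (n x : ℂ) = (Real.sqrt (n x) : ℂ) ^ 2 := by
      rw [← Complex.ofReal_pow, Real.sq_sqrt (by positivity)]; simp
    have hb := Complex.exp_bound hx (n := 3) (by norm_num)
    have h4 : (n x : ℂ) / lam * (Complex.exp (lam * u x / (Real.sqrt (n x) : ℂ)) - 1 -
        lam * u x / (Real.sqrt (n x) : ℂ)) - lam * u x ^ 2 / 2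
        = (n x : ℂ) / lam * (Complex.exp (lam * u x / (Real.sqrt (n x) : ℂ)) -
          ∑ m ∈ Finset.range 3, (lam * u x / (Real.sqrt (n x) : ℂ)) ^ m / (m.factorial : ℂ)) := by
      simp only [Finset.sum_range_succ, Finset.sum_range_zero, Nat.factorial]
      rw [hsq]
      push_cast
      field_simp
      ring
    rw [h4, norm_mul]
    -- For `u x = 0` the quotient on the right is the default `0`, so this case is set apart.
    have h5 : ‖(n x : ℂ) / lam‖ = ‖(lam : ℂ) * u x‖ ^ 2 / lam / ‖lam * u x / (Real.sqrt (n x) : ℂ)‖ ^ 2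
        ∨ u x = 0 := by
      by_cases hu0 : u x = 0
      · exact Or.inr hu0
      · left
        have : 0 < ‖u x‖ := norm_pos_iff.2 hu0
        rw [hsq]
        simp only [norm_div, norm_mul, norm_pow, Complex.norm_real, Real.norm_of_nonneg hs.le,
          Real.norm_of_nonneg hlam.le]
        field_simp
    rcases h5 with h5 | h5
    · by_cases hy0 : ‖lam * u x / (Real.sqrt (n x) : ℂ)‖ = 0
      · rw [h5, hy0]; simp
      · calc ‖(n x : ℂ) / lam‖ * _ ≤ ‖(n x : ℂ) / lam‖ * (‖lam * u x / (Real.sqrt (n x) : ℂ)‖ ^ 3 * 1) := by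
              gcongr
              refine hb.trans ?_
              gcongr
              norm_num [Nat.factorial]
          _ = _ := by rw [h5]; field_simp
    · rw [h5]; norm_num [Finset.sum_range_succ]
  refine (h1.add h2).congr fun x => by ring

/-- The argument `u` may move with the filter. This covers the integrand at fixed `t` and also the
denominator `f(r_n q)`, where `u = √n log q` tends to `w`. -/
theorem tendsto_saddleQuotient {f : ℂ → ℂ} {lam ε : ℝ} {A b ζ : ℂ} (hlam : 0 < lam) (hε : 0 < ε)
    (hf : Tendsto (fun v => f (ζ * Complex.exp v) / Complex.exp (b * v + Complex.exp (lam * v)))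
      (stripFilter ε) (𝓝 A))
    (hn : Tendsto n l atTop) {u : X → ℂ} {u₀ : ℂ} (hu : Tendsto u l (𝓝 u₀)) :
    Tendsto (fun x => saddleQuotient f lam b ζ (n x) (u x)) l
      (𝓝 (A * Complex.exp (lam * u₀ ^ 2 / 2))) := by
  have hy := tendsto_div_sqrt hn hu
  have hv : Tendsto (fun x => (logRadius lam (n x) : ℂ) + u x / (Real.sqrt (n x) : ℂ)) l
      (stripFilter ε) := by
    refine tendsto_inf.2 ⟨tendsto_comap_iff.2 ?_, tendsto_principal.2 ?_⟩
    · have h1 : Tendsto (fun x => (u x / (Real.sqrt (n x) : ℂ)).re) l (𝓝 0) :=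
        (Complex.continuous_re.tendsto 0).comp hy
      exact ((tendsto_logRadius hlam).comp hn).atTop_add h1
    · have h1 : Tendsto (fun x => |(u x / (Real.sqrt (n x) : ℂ)).im|) l (𝓝 0) := by
        simpa using ((Complex.continuous_im.tendsto 0).comp hy).abs
      filter_upwards [h1.eventually_le_const hε] with x hx
      simpa using hx
  have h1 := (tendsto_const_nhds (x := b)).mul hy
  have h2 := (h1.add (tendsto_gaussian_exponent hlam hn hu)).cexp
  rw [mul_zero, zero_add] at h2
  refine ((hf.comp hv).mul h2).congr' ?_
  filter_upwards [hn.eventually_gt_atTop 0] with x hx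
  exact (saddleQuotient_eq hlam b ζ hx (u x)).symm

/-- The real part of the exponent is `(n/λ)(cos x - 1)` with `x = λt/√n`, up to a bounded term from
`b`. The inequality `cos x ≤ 1 - 2x²/π²` on `|x| ≤ π` gives the Gaussian bound; this is why the
sector must satisfy `λε ≤ π`. -/
theorem exists_norm_saddleQuotient_le {f : ℂ → ℂ} {lam ε : ℝ} {A b ζ : ℂ} (hlam : 0 < lam)
    (hlε : lam * ε ≤ Real.pi)
    (hf : Tendsto (fun v => f (ζ * Complex.exp v) / Complex.exp (b * v + Complex.exp (lam * v)))
      (stripFilter ε) (𝓝 A)) :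
    ∃ C : ℝ, ∀ᶠ n : ℕ in atTop, ∀ t : ℝ, |t| ≤ ε * Real.sqrt n →
      ‖saddleQuotient f lam b ζ n (Complex.I * t)‖
        ≤ C * Real.exp (-(2 * lam / Real.pi ^ 2) * t ^ 2) := by
  have h1 := hf.norm.eventually_le_const (lt_add_one ‖A‖)
  rw [stripFilter, eventually_inf_principal, eventually_comap] at h1
  refine ⟨(‖A‖ + 1) * Real.exp (‖b‖ * ε), ?_⟩
  filter_upwards [(tendsto_logRadius hlam).eventually h1, eventually_gt_atTop 0] with n hn hn0 t ht
  have hn' : (0 : ℝ) < n := by exact_mod_cast hn0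
  have hs : (0 : ℝ) < Real.sqrt n := Real.sqrt_pos.2 hn'
  have hts : |t / Real.sqrt n| ≤ ε := by
    rw [abs_div, abs_of_pos hs, div_le_iff₀ hs]; exact ht
  have hcast : Complex.I * t / (Real.sqrt n : ℂ) = ((t / Real.sqrt n : ℝ) : ℂ) * Complex.I := by
    push_cast; ring
  rw [saddleQuotient_eq hlam b ζ hn0, norm_mul, mul_assoc]
  refine mul_le_mul (hn _ ?_ ?_) ?_ (norm_nonneg _) (by positivity)
  · rw [hcast]; simp
  · show |_| ≤ ε
    rw [hcast, Complex.add_im, Complex.ofReal_im, zero_add, Complex.im_ofReal_mul, Complex.I_im,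
      mul_one]
    exact hts
  · rw [Complex.norm_exp, ← Real.exp_add]
    apply Real.exp_le_exp.2
    rw [Complex.add_re]
    refine add_le_add ?_ ?_
    · refine (Complex.re_le_norm _).trans ?_
      rw [norm_mul, hcast]
      simp only [norm_mul, Complex.norm_real, Complex.norm_I, mul_one]
      exact mul_le_mul_of_nonneg_left hts (norm_nonneg _)
    · have h2 : (lam : ℂ) * (Complex.I * t) / (Real.sqrt n : ℂ)
          = ((lam * (t / Real.sqrt n) : ℝ) : ℂ) * Complex.I := by
        push_cast; ring
      have h3 : (n : ℂ) / lam = ((n / lam : ℝ) : ℂ) := by push_cast; rfl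
      rw [h2, h3, Complex.re_ofReal_mul, Complex.sub_re, Complex.sub_re, Complex.one_re,
        Complex.exp_ofReal_mul_I_re, Complex.re_ofReal_mul, Complex.I_re, mul_zero, sub_zero]
      have h4 := Real.cos_le_one_sub_mul_cos_sq (x := lam * (t / Real.sqrt n)) (by
        rw [abs_mul, abs_of_pos hlam]
        exact (mul_le_mul_of_nonneg_left hts hlam.le).trans hlε)
      have h5 : -(2 * lam / Real.pi ^ 2) * t ^ 2
          = n / lam * (-(2 / Real.pi ^ 2 * (lam * (t / Real.sqrt n)) ^ 2)) := by
        rw [mul_pow, div_pow, Real.sq_sqrt hn'.le]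
        field_simp
      rw [h5]
      exact mul_le_mul_of_nonneg_left (by linarith) (by positivity)

/-- Dominated convergence with the Gaussian bound. A general countably generated filter allows `n`
and `w` to vary together, which later gives uniformity in `w`. -/
theorem tendsto_integral_saddleQuotient [l.IsCountablyGenerated] {f : ℂ → ℂ} {lam ε : ℝ} {A b ζ : ℂ}
    (hfc : Continuous f) (hlam : 0 < lam) (hε : 0 < ε) (hlε : lam * ε ≤ Real.pi)
    (hf : Tendsto (fun v => f (ζ * Complex.exp v) / Complex.exp (b * v + Complex.exp (lam * v)))
      (stripFilter ε) (𝓝 A))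
    (hn : Tendsto n l atTop) {K : X → ℝ → ℂ} {k : ℝ → ℂ} (hKm : ∀ x, Measurable (K x)) {M : ℝ}
    (hKb : ∀ᶠ x in l, ∀ t : ℝ, |t| ≤ ε * Real.sqrt (n x) → ‖K x t‖ ≤ M)
    (hK : ∀ t, Tendsto (fun x => K x t) l (𝓝 (k t))) :
    Tendsto (fun x => ∫ t in (-(ε * Real.sqrt (n x)))..(ε * Real.sqrt (n x)),
      saddleQuotient f lam b ζ (n x) (Complex.I * t) * K x t) l
      (𝓝 (∫ t : ℝ, A * (Complex.exp (-(lam / 2) * (t : ℂ) ^ 2) * k t))) := by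
  obtain ⟨C, hC⟩ := exists_norm_saddleQuotient_le hlam hlε hf
  have hrw : ∀ x, ∫ t in (-(ε * Real.sqrt (n x)))..(ε * Real.sqrt (n x)),
      saddleQuotient f lam b ζ (n x) (Complex.I * t) * K x t
      = ∫ t : ℝ, (Set.Ioc (-(ε * Real.sqrt (n x))) (ε * Real.sqrt (n x))).indicator
        (fun t : ℝ => saddleQuotient f lam b ζ (n x) (Complex.I * t) * K x t) t := fun x => by
    rw [integral_indicator measurableSet_Ioc, intervalIntegral.integral_of_le]
    have : 0 ≤ ε * Real.sqrt (n x) := by positivity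
    linarith
  simp_rw [hrw]
  refine tendsto_integral_filter_of_dominated_convergence
    (fun t => C * Real.exp (-(2 * lam / Real.pi ^ 2) * t ^ 2) * M) ?_ ?_ ?_ ?_
  · refine Eventually.of_forall fun x => Measurable.aestronglyMeasurable ?_
    refine Measurable.indicator (Measurable.mul ?_ (hKm x)) measurableSet_Ioc
    unfold saddleQuotient
    refine (Measurable.div ?_ ?_)
    · exact (hfc.comp (by fun_prop)).measurable
    · exact Continuous.measurable (by fun_prop)
  · filter_upwards [hn.eventually hC, hKb] with x h1 h2
    refine Eventually.of_forall fun t => ?_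
    by_cases ht : t ∈ Set.Ioc (-(ε * Real.sqrt (n x))) (ε * Real.sqrt (n x))
    · rw [Set.indicator_of_mem ht, norm_mul]
      have ht' : |t| ≤ ε * Real.sqrt (n x) := abs_le.2 ⟨ht.1.le, ht.2⟩
      exact mul_le_mul (h1 t ht') (h2 t ht') (norm_nonneg _) ((norm_nonneg _).trans (h1 t ht'))
    · rw [Set.indicator_of_notMem ht, norm_zero]
      have h0 : |(0 : ℝ)| ≤ ε * Real.sqrt (n x) := by rw [abs_zero]; positivity
      have hC0 : 0 ≤ C := by simpa using (norm_nonneg _).trans (h1 0 h0)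
      have hM0 : 0 ≤ M := (norm_nonneg _).trans (h2 0 h0)
      positivity
  · exact ((integrable_exp_neg_mul_sq (by positivity)).const_mul C).mul_const M
  · refine Eventually.of_forall fun t => ?_
    have h1 := (tendsto_saddleQuotient hlam hε hf hn
      (tendsto_const_nhds (x := Complex.I * (t : ℂ)))).mul (hK t)
    have h2 : A * Complex.exp (lam * (Complex.I * t) ^ 2 / 2) * k t
        = A * (Complex.exp (-(lam / 2) * (t : ℂ) ^ 2) * k t) := by
      rw [mul_assoc]; congr 3
      rw [mul_pow, Complex.I_sq]; ring
    rw [h2] at h1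
    refine h1.congr' ?_
    have h3 : Tendsto (fun x => ε * Real.sqrt (n x)) l atTop :=
      (tendsto_sqrt_natCast.comp hn).const_mul_atTop hε
    filter_upwards [h3.eventually_gt_atTop |t|] with x hx
    rw [Set.indicator_of_mem]
    exact ⟨(abs_lt.1 hx).1, (abs_lt.1 hx).2.le⟩

end Saddle

/-! ### Contributions of the arcs and limits of the kernels -/

section SectionLimit

open MeasureTheory

/-- `f` has finitely many saddle directions `ζ i`, each in its own sector of half-width `ε`, and
smaller exponential type elsewhere. -/
structure HasSaddles {ι : Type*} (f : ℂ → ℂ) (lam mu ε : ℝ) (A b ζ : ι → ℂ) : Prop where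
  norm_dir : ∀ i, ‖ζ i‖ = 1
  dir_ne : ∀ i j, i ≠ j → ζ i ≠ ζ j
  coeff_ne : ∀ i, A i ≠ 0
  disj : ∀ i j, i ≠ j → Disjoint (closedSector (ζ i) ε) (closedSector (ζ j) ε)
  growth : ∀ i, Tendsto
    (fun v => f (ζ i * Complex.exp v) / Complex.exp (b i * v + Complex.exp (lam * v)))
    (stripFilter ε) (𝓝 (A i))
  rest : ∃ C R : ℝ, ∀ z, R ≤ ‖z‖ → z ∉ ⋃ i, closedSector (ζ i) ε →
    ‖f z‖ ≤ C * Real.exp (mu * ‖z‖ ^ lam)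

/-- Substitution `φ = t/√n`. The factor `s^{-n}` absorbs the linear term of the exponent and leaves
the character `ζ^{-n}`. -/
theorem integral_sector_eq {lam ε : ℝ} (hlam : 0 < lam) (f : ℂ → ℂ) (b : ℂ) {ζ : ℂ} (hζ : ζ ≠ 0)
    {n : ℕ} (hn : 0 < n) (q : ℂ) :
    ∫ φ in (-ε)..ε, f (scalingRadius lam n * (ζ * Complex.exp (φ * Complex.I))) /
        (ζ * Complex.exp (φ * Complex.I)) ^ n / (1 - q / (ζ * Complex.exp (φ * Complex.I)))
      = ζ⁻¹ ^ n * Complex.exp (b * logRadius lam n + n / lam) *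
        ∫ t in (-(ε * Real.sqrt n))..(ε * Real.sqrt n), saddleQuotient f lam b ζ n (Complex.I * t) *
          ((Real.sqrt n : ℂ)⁻¹ / (1 - q / (ζ * Complex.exp (Complex.I * t / (Real.sqrt n : ℂ))))) := by
  have hs : (0 : ℝ) < Real.sqrt n := Real.sqrt_pos.2 (by exact_mod_cast hn)
  have hs0 : (Real.sqrt n : ℂ) ≠ 0 := by exact_mod_cast hs.ne'
  have hsq : (n : ℂ) = (Real.sqrt n : ℂ) * (Real.sqrt n : ℂ) := by
    rw [← Complex.ofReal_mul, Real.mul_self_sqrt (by positivity)]; simp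
  set F : ℝ → ℂ := fun φ => f (scalingRadius lam n * (ζ * Complex.exp (φ * Complex.I))) /
        (ζ * Complex.exp (φ * Complex.I)) ^ n / (1 - q / (ζ * Complex.exp (φ * Complex.I))) with hF
  have h1 := intervalIntegral.integral_comp_div (a := -(ε * Real.sqrt n)) (b := ε * Real.sqrt n) F hs.ne'
  rw [neg_div, mul_div_cancel_right₀ _ hs.ne', eq_comm, ← eq_inv_smul_iff₀ hs.ne'] at h1
  rw [h1, ← intervalIntegral.integral_smul, ← intervalIntegral.integral_const_mul]
  refine intervalIntegral.integral_congr fun t _ => ?_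
  have h2 : ((t / Real.sqrt n : ℝ) : ℂ) * Complex.I = Complex.I * t / (Real.sqrt n : ℂ) := by
    push_cast; ring
  simp only [hF, h2, saddleQuotient, Complex.real_smul]
  have h3 : (scalingRadius lam n : ℂ) * (ζ * Complex.exp (Complex.I * t / (Real.sqrt n : ℂ)))
      = ζ * Complex.exp (logRadius lam n + Complex.I * t / (Real.sqrt n : ℂ)) := by
    rw [Complex.exp_add, ← Complex.ofReal_exp, exp_logRadius hlam hn]; ring
  have h4 : Complex.exp (b * logRadius lam n + n / lam + (Real.sqrt n : ℂ) * (Complex.I * t))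
      = Complex.exp (b * logRadius lam n + n / lam) *
        Complex.exp (Complex.I * t / (Real.sqrt n : ℂ)) ^ n := by
    rw [Complex.exp_add, ← Complex.exp_nat_mul]
    congr 2
    rw [hsq]; field_simp
  rw [h3, h4, mul_pow, inv_pow]
  have e1 := Complex.exp_ne_zero (b * logRadius lam n + n / lam)
  have e2 := Complex.exp_ne_zero (Complex.I * t / (Real.sqrt n : ℂ))
  generalize 1 - q / (ζ * Complex.exp (Complex.I * t / (Real.sqrt n : ℂ))) = d
  push_cast
  field_simp

variable {X : Type*} {l : Filter X} {n : X → ℕ} {w : X → ℂ} {w₀ : ℂ}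

theorem tendsto_one_add_div_sqrt (hn : Tendsto n l atTop) (hw : Tendsto w l (𝓝 w₀)) :
    Tendsto (fun x => 1 + w x / (Real.sqrt (n x) : ℂ)) l (𝓝 1) := by
  simpa using (tendsto_div_sqrt hn hw).const_add 1

/-- The pole stays inside the unit circle at distance at least a constant over `√n`; this bounds the
singular kernel. -/
theorem eventually_le_sqrt_mul_one_sub_norm (hn : Tendsto n l atTop) (hw : Tendsto w l (𝓝 w₀))
    (hw₀ : w₀.re < 0) : ∀ᶠ x in l, -w₀.re / 2 ≤
      Real.sqrt (n x) * (1 - ‖1 + w x / (Real.sqrt (n x) : ℂ)‖) := by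
  have h1 : Tendsto (fun x => -(w x).re - ‖w x‖ * ‖w x / (Real.sqrt (n x) : ℂ)‖ / 2) l
      (𝓝 (-w₀.re - ‖w₀‖ * ‖(0 : ℂ)‖ / 2)) :=
    (((Complex.continuous_re.tendsto w₀).comp hw).neg).sub
      ((hw.norm.mul (tendsto_div_sqrt hn hw).norm).div_const 2)
  rw [norm_zero, mul_zero, zero_div, sub_zero] at h1
  filter_upwards [h1.eventually_const_le (show -w₀.re / 2 < -w₀.re by linarith),
    hn.eventually_gt_atTop 0] with x hx hnx
  have hs : (0 : ℝ) < Real.sqrt (n x) := Real.sqrt_pos.2 (by exact_mod_cast hnx)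
  set s := Real.sqrt (n x)
  set p := ‖1 + w x / (s : ℂ)‖ with hp
  have hp2 : p ^ 2 = 1 + 2 * (w x).re / s + ‖w x‖ ^ 2 / s ^ 2 := by
    rw [hp, ← Complex.normSq_eq_norm_sq, ← Complex.normSq_eq_norm_sq, Complex.normSq_apply,
      Complex.normSq_apply, ← Complex.ofReal_one, Complex.add_re, Complex.add_im,
      Complex.div_ofReal_re, Complex.div_ofReal_im, Complex.ofReal_re, Complex.ofReal_im]
    field_simp; ring
  have h2 : ‖w x‖ * ‖w x / (s : ℂ)‖ / 2 = ‖w x‖ ^ 2 / s / 2 := by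
    rw [norm_div, Complex.norm_real, Real.norm_of_nonneg hs.le]; ring
  rw [h2] at hx
  have h3 : s * (1 - p ^ 2) = 2 * (-(w x).re - ‖w x‖ ^ 2 / s / 2) := by
    rw [hp2]; field_simp; ring
  have h4 : s * (1 - p ^ 2) ≤ s * (2 * (1 - p)) :=
    mul_le_mul_of_nonneg_left (by nlinarith [sq_nonneg (1 - p)]) hs.le
  linarith

theorem tendsto_sqrt_mul_log_one_add (hn : Tendsto n l atTop) (hw : Tendsto w l (𝓝 w₀)) :
    Tendsto (fun x => (Real.sqrt (n x) : ℂ) * Complex.log (1 + w x / (Real.sqrt (n x) : ℂ))) l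
      (𝓝 w₀) := by
  have hy := tendsto_div_sqrt hn hw
  have hyn := hy.norm
  rw [norm_zero] at hyn
  have h1 : Tendsto (fun x => (Real.sqrt (n x) : ℂ) *
      Complex.log (1 + w x / (Real.sqrt (n x) : ℂ)) - w x) l (𝓝 0) := by
    have h2 := hw.norm.mul hyn
    rw [mul_zero] at h2
    refine squeeze_zero_norm' ?_ h2
    filter_upwards [hyn.eventually_le_const (show (0 : ℝ) < 1 / 2 by norm_num),
      hn.eventually_gt_atTop 0] with x hx hnx
    have hs : (0 : ℝ) < Real.sqrt (n x) := Real.sqrt_pos.2 (by exact_mod_cast hnx)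
    have hs0 : (Real.sqrt (n x) : ℂ) ≠ 0 := by exact_mod_cast hs.ne'
    have h3 := Complex.norm_log_one_add_sub_self_le (z := w x / (Real.sqrt (n x) : ℂ)) (by linarith)
    have h4 : (1 - ‖w x / (Real.sqrt (n x) : ℂ)‖)⁻¹ ≤ 2 := by
      rw [inv_le_comm₀ (by linarith) (by norm_num)]; linarith
    have h5 : (Real.sqrt (n x) : ℂ) * Complex.log (1 + w x / (Real.sqrt (n x) : ℂ)) - w x
        = (Real.sqrt (n x) : ℂ) * (Complex.log (1 + w x / (Real.sqrt (n x) : ℂ)) -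
          w x / (Real.sqrt (n x) : ℂ)) := by field_simp
    have h6 : ‖w x‖ = Real.sqrt (n x) * ‖w x / (Real.sqrt (n x) : ℂ)‖ := by
      rw [norm_div, Complex.norm_real, Real.norm_of_nonneg hs.le]; field_simp
    rw [h5, norm_mul, Complex.norm_real, Real.norm_of_nonneg hs.le, h6, mul_assoc]
    refine mul_le_mul_of_nonneg_left (h3.trans ?_) hs.le
    have := mul_le_mul_of_nonneg_left h4 (sq_nonneg ‖w x / (Real.sqrt (n x) : ℂ)‖)
    linarith
  simpa using h1.add hw

theorem tendsto_main_kernel (hn : Tendsto n l atTop) (hw : Tendsto w l (𝓝 w₀))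
    (hw₀ : w₀.re < 0) (t : ℝ) :
    Tendsto (fun x => (Real.sqrt (n x) : ℂ)⁻¹ / (1 - (1 + w x / (Real.sqrt (n x) : ℂ)) /
      (1 * Complex.exp (Complex.I * t / (Real.sqrt (n x) : ℂ))))) l
      (𝓝 (1 / (Complex.I * t - w₀))) := by
  have hc : Tendsto (fun _ : X => -(Complex.I * (t : ℂ))) l (𝓝 (-(Complex.I * t))) := tendsto_const_nhds
  have hy := tendsto_div_sqrt hn hc
  have hyn := hy.norm
  rw [norm_zero] at hyn
  have h1 : Tendsto (fun x => (Real.sqrt (n x) : ℂ) *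
      (1 - Complex.exp (-(Complex.I * t) / (Real.sqrt (n x) : ℂ))) - Complex.I * t) l (𝓝 0) := by
    have h2 := hyn.const_mul ‖Complex.I * (t : ℂ)‖
    rw [mul_zero] at h2
    refine squeeze_zero_norm' ?_ h2
    filter_upwards [hyn.eventually_le_const (show (0 : ℝ) < 1 by norm_num),
      hn.eventually_gt_atTop 0] with x hx hnx
    have hs : (0 : ℝ) < Real.sqrt (n x) := Real.sqrt_pos.2 (by exact_mod_cast hnx)
    have hs0 : (Real.sqrt (n x) : ℂ) ≠ 0 := by exact_mod_cast hs.ne'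
    have h3 := Complex.norm_exp_sub_one_sub_id_le hx
    have h5 : (Real.sqrt (n x) : ℂ) *
        (1 - Complex.exp (-(Complex.I * t) / (Real.sqrt (n x) : ℂ))) - Complex.I * t
        = -((Real.sqrt (n x) : ℂ) * (Complex.exp (-(Complex.I * t) / (Real.sqrt (n x) : ℂ)) - 1 -
          -(Complex.I * t) / (Real.sqrt (n x) : ℂ))) := by field_simp; ring
    have h6 : ‖Complex.I * (t : ℂ)‖ = Real.sqrt (n x) * ‖-(Complex.I * t) / (Real.sqrt (n x) : ℂ)‖ := by
      rw [norm_div, norm_neg, Complex.norm_real, Real.norm_of_nonneg hs.le]; field_simp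
    rw [h5, norm_neg, norm_mul, Complex.norm_real, Real.norm_of_nonneg hs.le, h6, mul_assoc, ← pow_two]
    exact mul_le_mul_of_nonneg_left h3 hs.le
  have h7 := (h1.add_const (Complex.I * (t : ℂ))).sub (hw.mul hy.cexp)
  rw [zero_add, Complex.exp_zero, mul_one] at h7
  have hne : Complex.I * t - w₀ ≠ 0 := fun h => by
    have := congrArg Complex.re h
    simp at this
    exact hw₀.ne this
  refine (h7.inv₀ hne).congr' ?_ |>.trans_eq (by rw [one_div])
  filter_upwards [hn.eventually_gt_atTop 0] with x hnx
  have hs : (0 : ℝ) < Real.sqrt (n x) := Real.sqrt_pos.2 (by exact_mod_cast hnx)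
  have hs0 : (Real.sqrt (n x) : ℂ) ≠ 0 := by exact_mod_cast hs.ne'
  rw [inv_div_left, one_mul, div_eq_mul_inv (1 + _) (Complex.exp _), ← Complex.exp_neg, neg_div]
  congr 1
  field_simp
  ring

theorem tendsto_other_kernel (hn : Tendsto n l atTop) (hw : Tendsto w l (𝓝 w₀)) {ζ : ℂ}
    (hζ0 : ζ ≠ 0) (hζ : ζ ≠ 1) (t : ℝ) :
    Tendsto (fun x => 1 / (1 - (1 + w x / (Real.sqrt (n x) : ℂ)) /
      (ζ * Complex.exp (Complex.I * t / (Real.sqrt (n x) : ℂ))))) l (𝓝 (1 / (1 - 1 / ζ))) := by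
  have h1 := (tendsto_div_sqrt hn (tendsto_const_nhds (x := Complex.I * (t : ℂ)) (f := l))).cexp
  have h2 := h1.const_mul ζ
  rw [Complex.exp_zero, mul_one] at h2
  refine tendsto_const_nhds.div (tendsto_const_nhds.sub
    ((tendsto_one_add_div_sqrt hn hw).div h2 hζ0)) fun h => hζ ?_
  field_simp at h
  linear_combination h

theorem exists_other_kernel_bound (hn : Tendsto n l atTop) (hw : Tendsto w l (𝓝 w₀)) {ζ : ℂ} {ε : ℝ}
    (hζ1 : ‖ζ‖ = 1) (hε : 0 < ε) (hεπ : ε < Real.pi)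
    (hdisj : Disjoint (closedSector 1 ε) (closedSector ζ ε)) :
    ∃ M : ℝ, ∀ᶠ x in l, ∀ t : ℝ, |t| ≤ ε * Real.sqrt (n x) →
      ‖1 / (1 - (1 + w x / (Real.sqrt (n x) : ℂ)) /
      (ζ * Complex.exp (Complex.I * t / (Real.sqrt (n x) : ℂ))))‖ ≤ M := by
  have hζ0 : ζ ≠ 0 := fun h => by simp [h] at hζ1
  -- The compact arc around `ζ` has a positive distance `c` from 1 by disjointness; the pole tends
  -- to 1, so half of `c` survives.
  obtain ⟨φ₀, hφ₀, hmin⟩ := isCompact_Icc.exists_isMinOn (s := Set.Icc (-ε) ε) ⟨0, by simp [hε.le]⟩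
    (f := fun φ : ℝ => ‖ζ * Complex.exp (φ * Complex.I) - 1‖) (Continuous.continuousOn (by fun_prop))
  set c := ‖ζ * Complex.exp (φ₀ * Complex.I) - 1‖ with hc
  have hcpos : 0 < c := by
    rw [hc, norm_pos_iff, sub_ne_zero]
    intro h
    have hin : ζ * Complex.exp (φ₀ * Complex.I) ∈ closedSector ζ ε := by
      rw [mul_exp_mem_closedSector_iff hζ0] <;>
        simp only [Complex.im_ofReal_mul, Complex.I_im, mul_one]
      · exact abs_le.2 hφ₀
      · linarith [hφ₀.1]
      · linarith [hφ₀.2]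
    rw [h] at hin
    exact hdisj.le_bot ⟨by simp [closedSector, hε.le], hin⟩
  have h1 := (tendsto_div_sqrt hn hw).norm
  rw [norm_zero] at h1
  refine ⟨2 / c, ?_⟩
  filter_upwards [h1.eventually_le_const (show 0 < c / 2 by positivity),
    hn.eventually_gt_atTop 0] with x hx hnx t ht
  have hs : (0 : ℝ) < Real.sqrt (n x) := Real.sqrt_pos.2 (by exact_mod_cast hnx)
  have hts : |t / Real.sqrt (n x)| ≤ ε := by
    rw [abs_div, abs_of_pos hs, div_le_iff₀ hs]; exact ht
  have hcast : Complex.I * t / (Real.sqrt (n x) : ℂ) = ((t / Real.sqrt (n x) : ℝ) : ℂ) * Complex.I := by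
    push_cast; ring
  rw [hcast]
  set e := ζ * Complex.exp (((t / Real.sqrt (n x) : ℝ) : ℂ) * Complex.I) with he
  have hen : ‖e‖ = 1 := by rw [he, norm_mul, hζ1, Complex.norm_exp_ofReal_mul_I, one_mul]
  have he0 : e ≠ 0 := fun h => by simp [h] at hen
  have h2 : c ≤ ‖e - 1‖ := hmin (abs_le.1 hts)
  have h3 : c / 2 ≤ ‖e - (1 + w x / (Real.sqrt (n x) : ℂ))‖ := by
    have := norm_sub_norm_le (e - 1) (w x / (Real.sqrt (n x) : ℂ))
    rw [sub_sub] at this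
    linarith
  rw [one_sub_div he0, one_div_div, norm_div, hen, div_le_div_iff₀ (by linarith) hcpos]
  linarith

theorem tendsto_rest_bound {lam : ℝ} (hlam : 0 < lam) (α : ℝ) {c : ℝ} (hc : 0 < c) :
    Tendsto (fun n : ℕ => Real.sqrt n * Real.exp (α * logRadius lam n - c * n)) atTop (𝓝 0) := by
  have h1 : Tendsto (fun n : ℕ => logRadius lam n / n) atTop (𝓝 0) := by
    have h2 : Tendsto (fun y : ℝ => Real.log y / y) atTop (𝓝 0) :=
      Real.isLittleO_log_id_atTop.tendsto_div_nhds_zero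
    have h3 := (h2.comp (tendsto_natCast_atTop_atTop.atTop_div_const hlam)).const_mul (1 / lam ^ 2)
    rw [mul_zero] at h3
    refine h3.congr' ?_
    filter_upwards [eventually_gt_atTop 0] with n hn
    have : (n : ℝ) ≠ 0 := by exact_mod_cast hn.ne'
    simp only [Function.comp_apply, logRadius]
    field_simp
  have h4 : Tendsto (fun n : ℕ => (Real.sqrt n)⁻¹) atTop (𝓝 0) :=
    tendsto_inv_atTop_zero.comp tendsto_sqrt_natCast
  have h5 := (h4.add (h1.const_mul α)).sub_const c
  rw [mul_zero, zero_add, zero_sub] at h5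
  have h6 := (tendsto_natCast_atTop_atTop (R := ℝ)).atTop_mul_neg (neg_lt_zero.2 hc) h5
  refine squeeze_zero' (Eventually.of_forall fun n => by positivity) ?_
    (Real.tendsto_exp_atBot.comp h6)
  filter_upwards [eventually_gt_atTop 0] with n hn
  have hs : (0 : ℝ) < Real.sqrt n := Real.sqrt_pos.2 (by exact_mod_cast hn)
  have hn' : (n : ℝ) ≠ 0 := by exact_mod_cast hn.ne'
  have h7 : Real.sqrt n ≤ Real.exp (Real.sqrt n) := by linarith [Real.add_one_le_exp (Real.sqrt n)]
  refine (mul_le_mul_of_nonneg_right h7 (Real.exp_pos _).le).trans (le_of_eq ?_)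
  rw [← Real.exp_add, Function.comp_apply]
  congr 1
  have h8 : (n : ℝ) * (Real.sqrt n)⁻¹ = Real.sqrt n := by
    nth_rewrite 1 [← Real.mul_self_sqrt (show (0 : ℝ) ≤ n by positivity)]
    field_simp
  have h9 : (n : ℝ) * (logRadius lam n / n) = logRadius lam n := by field_simp
  linear_combination -h8 - α * h9

end SectionLimit

/-! ### Asymptotics of the sections and the criterion for the limit -/

section SectionLimitMain

open MeasureTheory

variable {X : Type*} {l : Filter X} {n : X → ℕ} {w : X → ℂ} {w₀ : ℂ}

/-- Source of the critical exponent: the ratio of the growth powers at radius `r_n` is `r_n^δ`, and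
the width of the saddle supplies `n^{-1/2}`. -/
theorem cexp_logRadius_mul_div_sqrt {lam : ℝ} (hlam : 0 < lam) (δ : ℂ) {n : ℕ} (hn : 0 < n) :
    Complex.exp (δ * logRadius lam n) * (Real.sqrt n : ℂ)⁻¹
      = (n : ℂ) ^ (δ / lam - 1 / 2) * Complex.exp (-(δ * Real.log lam / lam)) := by
  have hn' : (0 : ℝ) < n := by exact_mod_cast hn
  have hn0 : (n : ℂ) ≠ 0 := by exact_mod_cast hn.ne'
  have hl : (lam : ℂ) ≠ 0 := by exact_mod_cast hlam.ne'
  have h1 : (Real.sqrt n : ℂ)⁻¹ = Complex.exp (-(Real.log n / 2)) := by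
    rw [← Complex.ofReal_inv, Real.sqrt_eq_rpow, Real.rpow_def_of_pos hn', ← Real.exp_neg]
    push_cast; congr 1; ring
  rw [h1, Complex.cpow_def_of_ne_zero hn0, ← Complex.exp_add, ← Complex.exp_add, logRadius,
    Real.log_div hn'.ne' hlam.ne', Complex.natCast_log]
  congr 1
  push_cast
  field_simp
  ring

theorem map_scaled_eq {f : ℂ → ℂ} {lam : ℝ} (hlam : 0 < lam) (b : ℂ) {n : ℕ} (hn : 0 < n) {q : ℂ}
    (hq : q ≠ 0) :
    f (scalingRadius lam n * q)
      = saddleQuotient f lam b 1 n ((Real.sqrt n : ℂ) * Complex.log q) *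
        (Complex.exp (b * logRadius lam n + n / lam) * q ^ n) := by
  have hs : (0 : ℝ) < Real.sqrt n := Real.sqrt_pos.2 (by exact_mod_cast hn)
  have hs0 : (Real.sqrt n : ℂ) ≠ 0 := by exact_mod_cast hs.ne'
  have hsq : (Real.sqrt n : ℂ) * (Real.sqrt n : ℂ) = n := by
    rw [← Complex.ofReal_mul, Real.mul_self_sqrt (by positivity)]; simp
  have h1 : Complex.exp (b * logRadius lam n + n / lam + (Real.sqrt n : ℂ) *
      ((Real.sqrt n : ℂ) * Complex.log q)) = Complex.exp (b * logRadius lam n + n / lam) * q ^ n := by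
    rw [Complex.exp_add, ← mul_assoc (Real.sqrt n : ℂ), hsq, Complex.exp_nat_mul, Complex.exp_log hq]
  rw [saddleQuotient, h1, mul_div_cancel_left₀ _ hs0, Complex.exp_add, Complex.exp_log hq,
    ← Complex.ofReal_exp, exp_logRadius hlam hn, one_mul,
    div_mul_cancel₀ _ (mul_ne_zero (Complex.exp_ne_zero _) (pow_ne_zero _ hq))]

theorem scalingRadius_pos {lam : ℝ} (hlam : 0 < lam) {n : ℕ} (hn : 0 < n) :
    0 < scalingRadius lam n := by
  rw [← exp_logRadius hlam hn]; exact Real.exp_pos _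

theorem scalingRadius_rpow {lam : ℝ} (hlam : 0 < lam) (n : ℕ) :
    scalingRadius lam n ^ lam = n / lam := by
  rw [scalingRadius, ← Real.rpow_mul (by positivity), one_div, inv_mul_cancel₀ hlam.ne', Real.rpow_one]

variable {ι : Type*} {f : ℂ → ℂ} {lam mu ε : ℝ} {A b ζ : ι → ℂ}

/-- Off the arcs `f` is at most of size `exp(μn/λ)` against the saddle size `exp(n/λ)`. The gain
`exp(-(1-μ)n/λ)` beats the power of `r_n` and the kernel bound of order `√n`. -/
theorem HasSaddles.tendsto_rest (h : HasSaddles f lam mu ε A b ζ) (hlam : 0 < lam) (hmu : mu < 1)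
    (b₀ : ℂ) (hn : Tendsto n l atTop) (hw : Tendsto w l (𝓝 w₀)) (hw₀ : w₀.re < 0) :
    Tendsto (fun x => Complex.exp (-(b₀ * logRadius lam (n x) + n x / lam)) *
      ∫ φ in (-Real.pi)..Real.pi, (⋃ i, closedSector (ζ i) ε)ᶜ.indicator
        (fun e => f (scalingRadius lam (n x) * e) / e ^ n x /
          (1 - (1 + w x / (Real.sqrt (n x) : ℂ)) / e)) (Complex.exp (φ * Complex.I))) l (𝓝 0) := by
  obtain ⟨C, R, hCR⟩ := h.rest
  set δ := -w₀.re / 2 with hδ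
  have hδpos : 0 < δ := by rw [hδ]; linarith
  have h1 := ((tendsto_rest_bound hlam (-b₀.re) (c := (1 - mu) / lam)
    (div_pos (by linarith) hlam)).comp hn).const_mul (|C| / δ * |Real.pi - -Real.pi|)
  rw [mul_zero] at h1
  refine squeeze_zero_norm' ?_ h1
  have hrad : ∀ᶠ k : ℕ in atTop, R ≤ scalingRadius lam k := by
    filter_upwards [(Real.tendsto_exp_atTop.comp (tendsto_logRadius hlam)).eventually_ge_atTop R,
      eventually_gt_atTop 0] with k hk hk0
    rwa [Function.comp_apply, exp_logRadius hlam hk0] at hk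
  filter_upwards [hn.eventually hrad, hn.eventually_gt_atTop 0,
    eventually_le_sqrt_mul_one_sub_norm hn hw hw₀] with x hx hnx hqx
  have hs : (0 : ℝ) < Real.sqrt (n x) := Real.sqrt_pos.2 (by exact_mod_cast hnx)
  set q := 1 + w x / (Real.sqrt (n x) : ℂ) with hq
  have hbound : ∀ φ ∈ Set.uIoc (-Real.pi) Real.pi, ‖(⋃ i, closedSector (ζ i) ε)ᶜ.indicator
      (fun e => f (scalingRadius lam (n x) * e) / e ^ n x / (1 - q / e))
      (Complex.exp ((φ : ℝ) * Complex.I))‖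
      ≤ |C| * Real.exp (mu * (n x / lam)) * (Real.sqrt (n x) / δ) := by
    intro φ _
    set e := Complex.exp ((φ : ℝ) * Complex.I) with he
    have hen : ‖e‖ = 1 := Complex.norm_exp_ofReal_mul_I φ
    have he0 : e ≠ 0 := Complex.exp_ne_zero _
    by_cases hmem : e ∈ (⋃ i, closedSector (ζ i) ε)ᶜ
    · rw [Set.indicator_of_mem hmem]
      have hrp := scalingRadius_pos hlam hnx
      have hnorm : ‖(scalingRadius lam (n x) : ℂ) * e‖ = scalingRadius lam (n x) := by
        rw [norm_mul, hen, Complex.norm_real, Real.norm_of_nonneg hrp.le, mul_one]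
      have hnot : (scalingRadius lam (n x) : ℂ) * e ∉ ⋃ i, closedSector (ζ i) ε := fun hm => by
        obtain ⟨i, hi⟩ := Set.mem_iUnion.1 hm
        refine hmem (Set.mem_iUnion.2 ⟨i, he0, ?_⟩)
        have := hi.2
        rwa [mul_div_assoc, Complex.arg_real_mul _ hrp] at this
      have h2 := hCR _ (by rw [hnorm]; exact hx) hnot
      rw [hnorm, scalingRadius_rpow hlam] at h2
      have h3 : δ / Real.sqrt (n x) ≤ ‖1 - q / e‖ := by
        have h4 := norm_sub_norm_le (1 : ℂ) (q / e)
        rw [norm_one, norm_div, hen, div_one] at h4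
        rw [div_le_iff₀ hs]
        nlinarith
      rw [norm_div, norm_div, norm_pow, hen, one_pow, div_one, div_eq_mul_inv]
      refine mul_le_mul (h2.trans (mul_le_mul_of_nonneg_right (le_abs_self C) (Real.exp_pos _).le))
        ?_ (by positivity) (by positivity)
      rw [← inv_div δ]
      exact inv_anti₀ (by positivity) h3
    · rw [Set.indicator_of_notMem hmem, norm_zero]; positivity
  have h5 := intervalIntegral.norm_integral_le_of_norm_le_const hbound
  rw [norm_mul]
  refine (mul_le_mul_of_nonneg_left h5 (norm_nonneg _)).trans (le_of_eq ?_)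
  rw [Function.comp_apply, Complex.norm_exp]
  have h6 : (-(b₀ * logRadius lam (n x) + n x / lam)).re
      = -(b₀.re * logRadius lam (n x) + n x / lam) := by
    rw [Complex.neg_re, Complex.add_re, Complex.re_mul_ofReal, Complex.div_ofReal_re,
      Complex.natCast_re]
  rw [h6, show -b₀.re * logRadius lam (n x) - (1 - mu) / lam * n x
    = -(b₀.re * logRadius lam (n x) + n x / lam) + mu * (n x / lam) by ring, Real.exp_add]
  ring

/-- The limit holds without any condition on the exponents, once the contributions of the other
saddles are added back. That the limits `c` are nonzero is what the necessity direction uses. -/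
theorem HasSaddles.tendsto_section_quotient [l.IsCountablyGenerated] [Fintype ι] [DecidableEq ι]
    (h : HasSaddles f lam mu ε A b ζ)
    (hf : Differentiable ℂ f) (hlam : 0 < lam) (hmu : mu < 1) (hε : 0 < ε) (hεπ : ε < Real.pi)
    (hlε : lam * ε ≤ Real.pi) (o : ι) (hζo : ζ o = 1) (hAo : A o = 1)
    (hn : Tendsto n l atTop) (hw : Tendsto w l (𝓝 w₀)) (hw₀ : w₀.re < 0) :
    ∃ (J : {i // i ≠ o} → X → ℂ) (c : {i // i ≠ o} → ℂ), (∀ i, c i ≠ 0) ∧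
      (∀ i, Tendsto (J i) l (𝓝 (c i))) ∧
      Tendsto (fun x =>
        maclaurinSum f (n x - 1) (scalingRadius lam (n x) * (1 + w x / (Real.sqrt (n x) : ℂ))) /
            f (scalingRadius lam (n x) * (1 + w x / (Real.sqrt (n x) : ℂ))) +
          ∑ i : {i // i ≠ o}, (ζ i)⁻¹ ^ n x * ((n x : ℂ) ^ ((b i - b o) / lam - 1 / 2) * J i x)) l
        (𝓝 (1 / 2 * cerfc (w₀ * (Real.sqrt (lam / 2) : ℂ)))) := by
  have hζ0 : ∀ i, ζ i ≠ 0 := fun i hi => by simpa [hi] using h.norm_dir i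
  set D : X → ℂ := fun x => saddleQuotient f lam (b o) 1 (n x)
    ((Real.sqrt (n x) : ℂ) * Complex.log (1 + w x / (Real.sqrt (n x) : ℂ))) with hD
  set E := Complex.exp (lam * w₀ ^ 2 / 2) with hE
  have hE0 : E ≠ 0 := Complex.exp_ne_zero _
  have hgo := h.growth o
  rw [hζo, hAo] at hgo
  have hDlim : Tendsto D l (𝓝 E) := by
    simpa using tendsto_saddleQuotient hlam hε hgo hn (tendsto_sqrt_mul_log_one_add hn hw)
  have hpi : (Real.pi : ℂ) ≠ 0 := by exact_mod_cast Real.pi_ne_zero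
  have h2E : 2 * (Real.pi : ℂ) * E ≠ 0 := mul_ne_zero (mul_ne_zero two_ne_zero hpi) hE0
  have hDinv : Tendsto (fun x => (2 * Real.pi * D x)⁻¹) l (𝓝 (2 * Real.pi * E)⁻¹) :=
    (hDlim.const_mul _).inv₀ h2E
  set S : X → ℂ := fun x => ∫ t in (-(ε * Real.sqrt (n x)))..(ε * Real.sqrt (n x)),
    saddleQuotient f lam (b o) 1 (n x) (Complex.I * t) * ((Real.sqrt (n x) : ℂ)⁻¹ /
      (1 - (1 + w x / (Real.sqrt (n x) : ℂ)) /
        (1 * Complex.exp (Complex.I * t / (Real.sqrt (n x) : ℂ))))) with hS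
  have hδ := eventually_le_sqrt_mul_one_sub_norm hn hw hw₀
  -- The saddle with the nearby pole; its kernel is bounded by the inverse of the scaled distance
  -- from the pole to the circle.
  have hSlim : Tendsto S l (𝓝 (Real.pi * E * cerfc (-(w₀ * (Real.sqrt (lam / 2) : ℂ))))) := by
    have := tendsto_integral_saddleQuotient hf.continuous hlam hε hlε hgo hn (M := (-w₀.re / 2)⁻¹)
      (K := fun x t => (Real.sqrt (n x) : ℂ)⁻¹ / (1 - (1 + w x / (Real.sqrt (n x) : ℂ)) /
        (1 * Complex.exp (Complex.I * t / (Real.sqrt (n x) : ℂ)))))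
      (fun x => by
        refine Measurable.div measurable_const (Measurable.sub measurable_const
          (Measurable.div measurable_const (Continuous.measurable (by fun_prop))))) ?_
      (tendsto_main_kernel hn hw hw₀)
    · simp only [one_mul] at this
      rw [integral_gaussian_div_sub hlam hw₀] at this
      simpa only [hS, one_mul] using this
    · filter_upwards [hδ, hn.eventually_gt_atTop 0] with x hx hnx t _
      have hs : (0 : ℝ) < Real.sqrt (n x) := Real.sqrt_pos.2 (by exact_mod_cast hnx)
      have hen : ‖(1 : ℂ) * Complex.exp (Complex.I * t / (Real.sqrt (n x) : ℂ))‖ = 1 := by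
        have : Complex.I * t / (Real.sqrt (n x) : ℂ)
          = ((t / Real.sqrt (n x) : ℝ) : ℂ) * Complex.I := by push_cast; ring
        rw [this, one_mul, Complex.norm_exp_ofReal_mul_I]
      have h4 := norm_sub_norm_le (1 : ℂ) ((1 + w x / (Real.sqrt (n x) : ℂ)) /
        (1 * Complex.exp (Complex.I * t / (Real.sqrt (n x) : ℂ))))
      rw [norm_one, norm_div, hen, div_one] at h4
      rw [norm_div, norm_inv, Complex.norm_real, Real.norm_of_nonneg hs.le, inv_div_left, mul_comm]
      exact inv_anti₀ (by linarith) (hx.trans (mul_le_mul_of_nonneg_left h4 hs.le))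
  set J₀ : {i // i ≠ o} → X → ℂ := fun i x =>
    ∫ t in (-(ε * Real.sqrt (n x)))..(ε * Real.sqrt (n x)),
    saddleQuotient f lam (b i) (ζ i) (n x) (Complex.I * t) *
      (1 / (1 - (1 + w x / (Real.sqrt (n x) : ℂ)) /
        (ζ i * Complex.exp (Complex.I * t / (Real.sqrt (n x) : ℂ))))) with hJ₀
  set d : {i // i ≠ o} → ℂ := fun i =>
    ∫ t : ℝ, A i * (Complex.exp (-(lam / 2) * (t : ℂ) ^ 2) * (1 / (1 - 1 / ζ i))) with hd
  have hζ1 : ∀ i : {i // i ≠ o}, ζ i ≠ 1 := fun i => hζo ▸ h.dir_ne i o i.2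
  have hd0 : ∀ i, d i ≠ 0 := fun i => by
    have hl : (0 : ℝ) < lam / 2 := by positivity
    have hl' : (lam : ℂ) ≠ 0 := by exact_mod_cast hlam.ne'
    rw [hd]
    simp only
    rw [integral_const_mul, integral_mul_const, integral_gaussian_complex (by simpa using hl)]
    refine mul_ne_zero (h.coeff_ne i) (mul_ne_zero ?_ (one_div_ne_zero fun h1 => hζ1 i ?_))
    · rw [Complex.cpow_def_of_ne_zero (div_ne_zero hpi (div_ne_zero hl' two_ne_zero))]; exact Complex.exp_ne_zero _
    · have := hζ0 i
      field_simp at h1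
      linear_combination h1
  have hJ₀lim : ∀ i, Tendsto (J₀ i) l (𝓝 (d i)) := fun i => by
    obtain ⟨M, hM⟩ := exists_other_kernel_bound (ε := ε) hn hw (h.norm_dir i) hε hεπ
      (by rw [← hζo]; exact h.disj o i i.2.symm)
    exact tendsto_integral_saddleQuotient hf.continuous hlam hε hlε (h.growth i) hn
      (fun x => Measurable.div measurable_const (Measurable.sub measurable_const
          (Measurable.div measurable_const (Continuous.measurable (by fun_prop))))) hM
      (tendsto_other_kernel hn hw (hζ0 i) (hζ1 i))
  refine ⟨fun i x => (2 * Real.pi * D x)⁻¹ *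
      Complex.exp (-((b i - b o) * Real.log lam / lam)) * J₀ i x,
    fun i => (2 * Real.pi * E)⁻¹ * Complex.exp (-((b i - b o) * Real.log lam / lam)) * d i,
    fun i => ?_, fun i => (hDinv.mul_const _).mul (hJ₀lim i), ?_⟩
  · exact mul_ne_zero (mul_ne_zero (inv_ne_zero h2E) (Complex.exp_ne_zero _)) (hd0 i)
  have hrest := h.tendsto_rest hlam hmu (b o) hn hw hw₀
  -- The quotient is `1 - (f - p)/f`, and `f(z)` is `D` times the exponential size of the saddle
  -- times `q^n`. The last two factors cancel against the remainder integral.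
  have hfin := ((hDinv.mul hSlim).add (hDinv.mul hrest)).const_sub 1
  have hval : 1 - ((2 * Real.pi * E)⁻¹ *
      (Real.pi * E * cerfc (-(w₀ * (Real.sqrt (lam / 2) : ℂ)))) + (2 * Real.pi * E)⁻¹ * 0)
      = 1 / 2 * cerfc (w₀ * (Real.sqrt (lam / 2) : ℂ)) := by
    have := cerfc_add_cerfc_neg (w₀ * (Real.sqrt (lam / 2) : ℂ))
    rw [← sub_eq_iff_eq_add'.2 this.symm]
    field_simp
    ring
  rw [hval] at hfin
  refine hfin.congr' ?_
  have hqlim := tendsto_one_add_div_sqrt hn hw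
  filter_upwards [hδ, hn.eventually_gt_atTop 0, hqlim.eventually_ne one_ne_zero,
    hDlim.eventually_ne hE0] with x hδx hnx hq0 hD0
  have hs : (0 : ℝ) < Real.sqrt (n x) := Real.sqrt_pos.2 (by exact_mod_cast hnx)
  have hs0 : (Real.sqrt (n x) : ℂ) ≠ 0 := by exact_mod_cast hs.ne'
  have hsec := fun i => integral_sector_eq (ε := ε) hlam f (b i) (hζ0 i) hnx
    (1 + w x / (Real.sqrt (n x) : ℂ))
  have hmap := map_scaled_eq (f := f) hlam (b o) hnx hq0
  set q := 1 + w x / (Real.sqrt (n x) : ℂ) with hq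
  have hq1 : ‖q‖ < 1 := by
    by_contra! hge
    nlinarith [mul_nonneg hs.le (sub_nonneg.2 hge)]
  have hrem := sub_maclaurinSum_eq_integral hf hnx (scalingRadius_pos hlam hnx) hq1
  have hcont : Continuous fun φ : ℝ => (fun e : ℂ => f (scalingRadius lam (n x) * e) / e ^ n x /
      (1 - q / e)) (Complex.exp (φ * Complex.I)) := by
    have he0 : ∀ φ : ℝ, Complex.exp (φ * Complex.I) ≠ 0 := fun φ => Complex.exp_ne_zero _
    have hc : Continuous fun φ : ℝ => Complex.exp (φ * Complex.I) := by fun_prop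
    refine Continuous.div (Continuous.div (hf.continuous.comp (continuous_const.mul hc))
      (hc.pow _) fun φ => pow_ne_zero _ (he0 φ)) (continuous_const.sub (continuous_const.div hc he0))
      fun φ h0 => ?_
    have h1 : q = Complex.exp (φ * Complex.I) := by
      rw [sub_eq_zero, eq_div_iff (he0 φ), one_mul] at h0; exact h0.symm
    rw [h1, Complex.norm_exp_ofReal_mul_I] at hq1
    exact lt_irrefl _ hq1
  have hdec := integral_circle_eq_sum_sectors (g := fun e : ℂ =>
    f (scalingRadius lam (n x) * e) / e ^ n x / (1 - q / e)) h.norm_dir hε hεπ h.disj hcont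
  beta_reduce at hdec
  rw [hdec] at hrem
  simp_rw [hsec] at hrem
  rw [Fintype.sum_eq_add_sum_subtype_ne _ o] at hrem
  set Rx := ∫ φ in (-Real.pi)..Real.pi, (⋃ i, closedSector (ζ i) ε)ᶜ.indicator
        (fun e => f (scalingRadius lam (n x) * e) / e ^ n x / (1 - q / e))
        (Complex.exp (φ * Complex.I)) with hRx
  set N := Complex.exp (b o * logRadius lam (n x) + n x / lam) with hN
  have hN0 : N ≠ 0 := Complex.exp_ne_zero _
  have hother : ∀ i : {i // i ≠ o}, (ζ i)⁻¹ ^ n x * Complex.exp (b i * logRadius lam (n x) + n x / lam) *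
      (∫ t in (-(ε * Real.sqrt (n x)))..(ε * Real.sqrt (n x)),
        saddleQuotient f lam (b i) (ζ i) (n x) (Complex.I * t) * ((Real.sqrt (n x) : ℂ)⁻¹ /
          (1 - q / (ζ i * Complex.exp (Complex.I * t / (Real.sqrt (n x) : ℂ))))))
      = N * ((ζ i)⁻¹ ^ n x * ((n x : ℂ) ^ ((b i - b o) / lam - 1 / 2) *
        (Complex.exp (-((b i - b o) * Real.log lam / lam)) * J₀ i x))) := fun i => by
    have h1 := cexp_logRadius_mul_div_sqrt hlam (b i - b o) hnx
    have h2 : Complex.exp (b i * logRadius lam (n x) + n x / lam)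
        = N * Complex.exp ((b i - b o) * logRadius lam (n x)) := by
      rw [hN, ← Complex.exp_add]; congr 1; ring
    have h3 : (∫ t in (-(ε * Real.sqrt (n x)))..(ε * Real.sqrt (n x)),
        saddleQuotient f lam (b i) (ζ i) (n x) (Complex.I * t) * ((Real.sqrt (n x) : ℂ)⁻¹ /
          (1 - q / (ζ i * Complex.exp (Complex.I * t / (Real.sqrt (n x) : ℂ))))))
        = (Real.sqrt (n x) : ℂ)⁻¹ * J₀ i x := by
      rw [hJ₀]
      simp only
      rw [← intervalIntegral.integral_const_mul]
      refine intervalIntegral.integral_congr fun t _ => ?_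
      ring
    rw [h2, h3]
    linear_combination (ζ i)⁻¹ ^ n x * N * J₀ i x * h1
  have hSx : (∫ t in (-(ε * Real.sqrt (n x)))..(ε * Real.sqrt (n x)),
        saddleQuotient f lam (b o) (ζ o) (n x) (Complex.I * t) * ((Real.sqrt (n x) : ℂ)⁻¹ /
          (1 - q / (ζ o * Complex.exp (Complex.I * t / (Real.sqrt (n x) : ℂ)))))) = S x := by
    rw [hζo]
  rw [hSx, Finset.sum_congr rfl fun i _ => hother i, ← Finset.mul_sum, hζo, inv_one, one_pow,
    one_mul] at hrem
  have hsum : ∑ i : {i // i ≠ o}, (ζ i)⁻¹ ^ n x * ((n x : ℂ) ^ ((b i - b o) / lam - 1 / 2) *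
        ((2 * Real.pi * D x)⁻¹ * Complex.exp (-((b i - b o) * Real.log lam / lam)) * J₀ i x))
      = (2 * Real.pi * D x)⁻¹ * ∑ i : {i // i ≠ o}, (ζ i)⁻¹ ^ n x *
        ((n x : ℂ) ^ ((b i - b o) / lam - 1 / 2) *
        (Complex.exp (-((b i - b o) * Real.log lam / lam)) * J₀ i x)) := by
    rw [Finset.mul_sum]
    exact Finset.sum_congr rfl fun i _ => by ring
  rw [hsum, Complex.exp_neg, ← hN]
  have hfx : f (scalingRadius lam (n x) * q) = D x * (N * q ^ n x) := hmap
  generalize (∑ i : {i // i ≠ o}, (ζ i)⁻¹ ^ n x * ((n x : ℂ) ^ ((b i - b o) / lam - 1 / 2) *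
        (Complex.exp (-((b i - b o) * Real.log lam / lam)) * J₀ i x))) = T at hrem ⊢
  have hp : maclaurinSum f (n x - 1) (scalingRadius lam (n x) * q)
      = D x * (N * q ^ n x) - q ^ n x / (2 * Real.pi) * (N * S x + N * T + Rx) := by
    rw [← hfx, ← hrem]; ring
  rw [hp, hfx]
  have hqn : q ^ n x ≠ 0 := pow_ne_zero _ hq0
  field_simp
  ring

/-- Szegő-type limit for sections in terms of saddle data. -/
theorem HasSaddles.section_limit_iff [Fintype ι] (h : HasSaddles f lam mu ε A b ζ)
    (hf : Differentiable ℂ f) (hlam : 0 < lam) (hmu : mu < 1) (hε : 0 < ε) (hεπ : ε < Real.pi)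
    (hlε : lam * ε ≤ Real.pi) (o : ι) (hζo : ζ o = 1) (hAo : A o = 1) :
    (∀ K : Set ℂ, IsCompact K → K ⊆ {w : ℂ | w.re < 0} →
      TendstoUniformlyOn
        (fun (n : ℕ) (w : ℂ) =>
          maclaurinSum f (n - 1) ((scalingRadius lam n : ℂ) * (1 + w / (Real.sqrt n : ℂ))) /
            f ((scalingRadius lam n : ℂ) * (1 + w / (Real.sqrt n : ℂ))))
        (fun w => 1 / 2 * cerfc (w * (Real.sqrt (lam / 2) : ℂ)))
        atTop K) ↔
      ∀ i, i ≠ o → (b i).re - (b o).re < lam / 2 := by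
  classical
  have hβ : ∀ i, ((b i - b o) / lam - 1 / 2).re < 0 ↔ (b i).re - (b o).re < lam / 2 := fun i => by
    rw [Complex.sub_re, Complex.div_ofReal_re, Complex.sub_re]
    norm_num
    rw [div_lt_iff₀ hlam]
    constructor <;> intro h <;> linarith
  constructor
  · intro hlim i hi
    -- One point suffices: the exponents do not depend on `w`.
    have h1 := hlim {-1} isCompact_singleton (by simp)
    rw [tendstoUniformlyOn_singleton_iff_tendsto] at h1
    obtain ⟨J, c, hc, hJ, hJl⟩ := h.tendsto_section_quotient hf hlam hmu hε hεπ hlε o hζo hAo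
      (l := atTop) (n := fun k : ℕ => k) tendsto_id (tendsto_const_nhds (x := (-1 : ℂ)))
      (by simp)
    have h2 := hJl.sub h1
    rw [sub_self] at h2
    rw [← hβ]
    refine re_neg_of_tendsto_sum_characters (ι := {i // i ≠ o}) (ζ := fun i => ζ i)
      (β := fun i => (b i - b o) / lam - 1 / 2) (fun i => h.norm_dir i)
      (fun i j hij => h.dir_ne i j fun e => hij (Subtype.ext e)) hc hJ ?_ ⟨i, hi⟩
    exact h2.congr fun k => by ring
  · intro hre K hK hKre
    -- On a compact set, uniform convergence is local, hence follows from a joint limit in `(n, w)`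
    -- at each `w₀ ∈ K`, given continuity of the limit function.
    rw [← tendstoLocallyUniformlyOn_iff_tendstoUniformlyOn_of_compact hK,
      tendstoLocallyUniformlyOn_iff_filter]
    intro w₀ hw₀
    have hn : Tendsto (fun p : ℕ × ℂ => p.1) (atTop ×ˢ 𝓝[K] w₀) atTop := tendsto_fst
    have hw : Tendsto (fun p : ℕ × ℂ => p.2) (atTop ×ˢ 𝓝[K] w₀) (𝓝 w₀) :=
      tendsto_snd.mono_right nhdsWithin_le_nhds
    obtain ⟨J, c, hc, hJ, hJl⟩ := h.tendsto_section_quotient hf hlam hmu hε hεπ hlε o hζo hAo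
      hn hw (hKre hw₀)
    have h3 : Tendsto (fun x : ℕ × ℂ => ∑ i : {i // i ≠ o}, (ζ i)⁻¹ ^ x.1 *
        ((x.1 : ℂ) ^ ((b i - b o) / lam - 1 / 2) * J i x)) (atTop ×ˢ 𝓝[K] w₀) (𝓝 0) := by
      suffices hs : ∀ i : {i // i ≠ o}, Tendsto (fun x : ℕ × ℂ => (ζ i)⁻¹ ^ x.1 *
          ((x.1 : ℂ) ^ ((b i - b o) / lam - 1 / 2) * J i x)) (atTop ×ˢ 𝓝[K] w₀) (𝓝 0) by
        simpa only [Finset.sum_const_zero] using tendsto_finsetSum Finset.univ fun i _ => hs i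
      intro i
      have h4 : Tendsto (fun x : ℕ × ℂ => (x.1 : ℝ) ^ ((b i - b o) / lam - 1 / 2).re * ‖J i x‖)
          (atTop ×ˢ 𝓝[K] w₀) (𝓝 (0 * ‖c i‖)) := by
        refine Tendsto.mul ?_ (hJ i).norm
        have h5 := tendsto_rpow_neg_atTop (neg_pos.2 ((hβ i).2 (hre i i.2)))
        rw [neg_neg] at h5
        exact h5.comp (tendsto_natCast_atTop_atTop.comp hn)
      rw [zero_mul] at h4
      refine squeeze_zero_norm' ?_ h4
      filter_upwards [hn.eventually_gt_atTop 0] with x hx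
      rw [norm_mul, norm_mul, norm_pow, norm_inv, h.norm_dir, inv_one, one_pow, one_mul,
        ← Complex.ofReal_natCast, Complex.norm_cpow_eq_rpow_re_of_pos (by exact_mod_cast hx)]
    have h6 := hJl.sub h3
    rw [sub_zero] at h6
    have h7 : Tendsto (fun x : ℕ × ℂ => 1 / 2 * cerfc (x.2 * (Real.sqrt (lam / 2) : ℂ)))
        (atTop ×ˢ 𝓝[K] w₀) (𝓝 (1 / 2 * cerfc (w₀ * (Real.sqrt (lam / 2) : ℂ)))) :=
      (((continuous_cerfc.tendsto _).comp (hw.mul_const _))).const_mul _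
    rw [tendstoUniformlyOnFilter_iff_tendsto]
    have h8 := (h7.prodMk_nhds h6).mono_right (nhds_le_uniformity _)
    refine h8.congr fun x => ?_
    simp only [add_sub_cancel_right]

end SectionLimitMain

/-! ### Logarithmic coordinates and the edges of the sectors -/

section Reduction

theorem mem_stripFilter_iff {ε : ℝ} {p : ℂ → Prop} :
    (∀ᶠ v in stripFilter ε, p v) ↔ ∃ T : ℝ, ∀ v : ℂ, T ≤ v.re → |v.im| ≤ ε → p v := by
  rw [stripFilter, eventually_inf_principal, eventually_comap, eventually_atTop]
  constructor
  · rintro ⟨T, hT⟩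
    exact ⟨T, fun v h1 h2 => hT v.re h1 v rfl h2⟩
  · rintro ⟨T, hT⟩
    exact ⟨T, fun t ht v hv h2 => hT v (hv ▸ ht) h2⟩

theorem stripFilter_neBot {ε : ℝ} (hε : 0 < ε) : (stripFilter ε).NeBot := by
  refine neBot_iff.2 fun h => ?_
  have : ∀ᶠ v in stripFilter ε, False := by rw [h]; exact eventually_bot
  obtain ⟨T, hT⟩ := mem_stripFilter_iff.1 this
  exact hT T (by simp) (by simp [hε.le])

theorem eventually_cobounded_inf_principal_iff {S : Set ℂ} {p : ℂ → Prop} :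
    (∀ᶠ z in cobounded ℂ ⊓ 𝓟 S, p z) ↔ ∃ R : ℝ, ∀ z, R ≤ ‖z‖ → z ∈ S → p z := by
  rw [eventually_inf_principal, ← comap_norm_atTop, eventually_comap, eventually_atTop]
  constructor
  · rintro ⟨T, hT⟩
    exact ⟨T, fun v h1 h2 => hT ‖v‖ h1 v rfl h2⟩
  · rintro ⟨T, hT⟩
    exact ⟨T, fun t ht v hv h2 => hT v (hv ▸ ht) h2⟩

theorem tendsto_mul_exp_stripFilter {ζ : ℂ} (hζ : ‖ζ‖ = 1) {θ : ℝ} (hθ : θ < Real.pi) :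
    Tendsto (fun v => ζ * Complex.exp v) (stripFilter θ)
      (cobounded ℂ ⊓ 𝓟 (closedSector ζ θ)) := by
  have hζ0 : ζ ≠ 0 := fun h => by simp [h] at hζ
  refine tendsto_inf.2 ⟨?_, tendsto_principal.2 ?_⟩
  · rw [← tendsto_norm_atTop_iff_cobounded]
    have : (fun v => ‖ζ * Complex.exp v‖) = Real.exp ∘ Complex.re := by
      ext v; rw [norm_mul, hζ, one_mul, Complex.norm_exp, Function.comp_apply]
    rw [this]
    exact Real.tendsto_exp_atTop.comp (tendsto_comap.mono_left inf_le_left)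
  · refine mem_stripFilter_iff.2 ⟨0, fun v _ hv => ?_⟩
    have := abs_le.1 hv
    exact (mul_exp_mem_closedSector_iff hζ0 (by linarith) (by linarith)).2 hv

/-- With `z = ζ e^v` and `|Im v| ≤ θ < π`, the principal powers of `z/ζ` are honest exponentials of
`v`. -/
theorem tendsto_div_of_isEquivalent {f : ℂ → ℂ} {lam θ : ℝ} {A b ζ : ℂ} (hζ : ‖ζ‖ = 1)
    (hθ : θ < Real.pi)
    (h : f ~[cobounded ℂ ⊓ 𝓟 (closedSector ζ θ)] directionModel lam A b ζ) :
    Tendsto (fun v => f (ζ * Complex.exp v) / Complex.exp (b * v + Complex.exp (lam * v)))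
      (stripFilter θ) (𝓝 A) := by
  have hζ0 : ζ ≠ 0 := fun h => by simp [h] at hζ
  obtain ⟨φ, hφ, hf⟩ := h.exists_eq_mul
  have ht := tendsto_mul_exp_stripFilter hζ hθ
  have h1 := (hφ.comp ht).mul_const A
  rw [one_mul] at h1
  refine h1.congr' ?_
  filter_upwards [ht.eventually hf, mem_stripFilter_iff.2 ⟨0, fun v _ hv => hv⟩] with v hv him
  have him' := abs_le.1 him
  have hlog : Complex.log (Complex.exp v) = v := Complex.log_exp (by linarith) (by linarith)
  rw [hv, Pi.mul_apply, directionModel, mul_div_cancel_left₀ _ hζ0,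
    Complex.cpow_def_of_ne_zero (Complex.exp_ne_zero _),
    Complex.cpow_def_of_ne_zero (Complex.exp_ne_zero _), hlog, mul_comm v b, mul_comm v (lam : ℂ),
    mul_assoc, ← Complex.exp_add, Function.comp_apply, ← mul_assoc,
    mul_div_cancel_right₀ _ (Complex.exp_ne_zero _)]

/-- The identity theorem in the variable `v`. It rules out a vanishing coefficient `A_k`, for which
asymptotic equivalence would mean that `f` vanishes far out in the sector. -/
theorem eq_zero_of_eventually_strip {f : ℂ → ℂ} (hf : Differentiable ℂ f) {ζ : ℂ} (hζ : ζ ≠ 0)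
    {θ : ℝ} (hθ : 0 < θ) (h : ∀ᶠ v in stripFilter θ, f (ζ * Complex.exp v) = 0) (z : ℂ)
    (hz : z ≠ 0) : f z = 0 := by
  obtain ⟨T, hT⟩ := mem_stripFilter_iff.1 h
  have hF : Differentiable ℂ fun v => f (ζ * Complex.exp v) := hf.comp (by fun_prop)
  have hz0 : (fun v => f (ζ * Complex.exp v)) = fun _ => 0 := by
    refine AnalyticOnNhd.eq_of_eventuallyEq (𝕜 := ℂ) (z₀ := ((T + 1 : ℝ) : ℂ))
      (fun v _ => hF.analyticAt v) (fun v _ => analyticAt_const) ?_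
    have h1 : ∀ᶠ v : ℂ in 𝓝 ((T + 1 : ℝ) : ℂ), T < v.re :=
      (Complex.continuous_re.tendsto _).eventually_const_lt (by simp)
    have h2 : ∀ᶠ v : ℂ in 𝓝 ((T + 1 : ℝ) : ℂ), |v.im| < θ :=
      (Complex.continuous_im.abs.tendsto _).eventually_lt_const (by simpa using hθ)
    filter_upwards [h1, h2] with v h1 h2
    exact hT v h1.le h2.le
  have := congrFun hz0 (Complex.log (z / ζ))
  rwa [Complex.exp_log (div_ne_zero hz hζ), mul_div_cancel₀ _ hζ] at this

/-- Double exponential decay dominates exponential growth. -/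
theorem tendsto_exp_sub_exp {lam c : ℝ} (hlam : 0 < lam) (hc : 0 < c) (α : ℝ) :
    Tendsto (fun t : ℝ => Real.exp (α * t - c * Real.exp (lam * t))) atTop (𝓝 0) := by
  have h1 : Tendsto (fun t : ℝ => t * (α - c * lam ^ 2 / 2 * t)) atTop atBot := by
    refine tendsto_id.atTop_mul_atBot₀ ?_
    have : Tendsto (fun t : ℝ => c * lam ^ 2 / 2 * t) atTop atTop :=
      tendsto_id.const_mul_atTop (by positivity)
    simpa [sub_eq_add_neg] using tendsto_atBot_add_const_left atTop α (tendsto_neg_atTop_atBot.comp this)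
  refine squeeze_zero' (Eventually.of_forall fun t => (Real.exp_pos _).le) ?_
    (Real.tendsto_exp_atBot.comp h1)
  filter_upwards [eventually_ge_atTop 0] with t ht
  apply Real.exp_le_exp.2
  have h2 := Real.quadratic_le_exp_of_nonneg (x := lam * t) (by positivity)
  have h3 : 0 ≤ lam * t := by positivity
  have h4 : c * ((lam * t) ^ 2 / 2) ≤ c * Real.exp (lam * t) :=
    mul_le_mul_of_nonneg_left (by linarith) hc.le
  linarith [show t * (α - c * lam ^ 2 / 2 * t) = α * t - c * ((lam * t) ^ 2 / 2) by ring]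

theorem exp_lam_mul_re {lam : ℝ} (v : ℂ) :
    (Complex.exp (lam * v)).re = Real.exp (lam * v.re) * Real.cos (lam * v.im) := by
  rw [Complex.exp_re, Complex.re_ofReal_mul, Complex.im_ofReal_mul]

theorem norm_mul_exp_rpow {ζ : ℂ} (hζ : ‖ζ‖ = 1) (lam : ℝ) (v : ℂ) :
    ‖ζ * Complex.exp v‖ ^ lam = Real.exp (lam * v.re) := by
  rw [norm_mul, hζ, one_mul, Complex.norm_exp, ← Real.exp_mul, mul_comm]

/-- The unoriented angle is continuous away from the origin, also across the cut where `arg` jumps.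
-/
theorem eventually_notMem_closedSector {ζ z : ℂ} (hζ : ζ ≠ 0) (hz : z ≠ 0) {θ : ℝ}
    (h : z ∉ closedSector ζ θ) : ∀ᶠ y in 𝓝 z, y ∉ closedSector ζ θ := by
  have h1 : θ < InnerProductGeometry.angle z ζ := by
    rw [Complex.angle_eq_abs_arg hz hζ]
    by_contra! hle
    exact h ⟨hz, hle⟩
  have h2 : ContinuousAt (fun y => InnerProductGeometry.angle y ζ) z :=
    (InnerProductGeometry.continuousAt_angle (x := (z, ζ)) hz hζ).comp
      (f := fun y : ℂ => (y, ζ)) (by fun_prop)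
  filter_upwards [h2.eventually_const_lt h1, isOpen_ne.mem_nhds hz] with y hy hy0 hmem
  rw [Complex.angle_eq_abs_arg hy0 hζ] at hy
  exact hy.not_ge hmem.2

/-- A maximal ray cannot be the edge of a sector, since `f` is smaller beyond the edge. -/
theorem cos_ne_one_of_growth {ι : Type*} [Finite ι] {f : ℂ → ℂ} {lam mu θ : ℝ} {A b ζ : ι → ℂ}
    (hf : Continuous f) (hlam : 0 < lam) (hmu : mu < 1) (hθ : 0 < θ) (hθπ : θ < Real.pi)
    (hζ : ∀ i, ‖ζ i‖ = 1)
    (hdisj : ∀ i j, i ≠ j → Disjoint (closedSector (ζ i) θ) (closedSector (ζ j) θ))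
    {C R : ℝ} (hrest : ∀ z, R ≤ ‖z‖ → z ∉ ⋃ i, closedSector (ζ i) θ →
      ‖f z‖ ≤ C * Real.exp (mu * ‖z‖ ^ lam)) (i : ι) (hA : A i ≠ 0)
    (hgrowth : Tendsto
      (fun v => f (ζ i * Complex.exp v) / Complex.exp (b i * v + Complex.exp (lam * v)))
      (stripFilter θ) (𝓝 (A i))) : Real.cos (lam * θ) ≠ 1 := by
  intro hcos
  have hζ0 : ∀ j, ζ j ≠ 0 := fun j hj => by simpa [hj] using hζ j
  set v : ℝ → ℝ → ℂ := fun t φ => (t : ℂ) + φ * Complex.I with hv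
  have hre : ∀ t φ, (v t φ).re = t := fun t φ => by simp [hv]
  have him : ∀ t φ, (v t φ).im = φ := fun t φ => by simp [hv]
  have hedge : ∀ t, R ≤ Real.exp t → ‖f (ζ i * Complex.exp (v t θ))‖
      ≤ C * Real.exp (mu * Real.exp (lam * t)) := by
    intro t ht
    have hcont : Continuous fun φ : ℝ => ζ i * Complex.exp (v t φ) := by
      simp only [hv]; fun_prop
    -- Just beyond the edge the points lie in no sector, since the other sectors are disjoint from
    -- this one and closed away from 0. The bound there passes to the edge by continuity of `f`.
    refine le_of_tendsto (f := fun φ : ℝ => ‖f (ζ i * Complex.exp (v t φ))‖)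
      (((hf.comp hcont).norm.tendsto θ).mono_left (nhdsWithin_le_nhds (s := Set.Ioi θ))) ?_
    have hz0 : ζ i * Complex.exp (v t θ) ≠ 0 := mul_ne_zero (hζ0 i) (Complex.exp_ne_zero _)
    have hmem : ζ i * Complex.exp (v t θ) ∈ closedSector (ζ i) θ := by
      rw [mul_exp_mem_closedSector_iff (hζ0 i) (by rw [him]; linarith) (by rw [him]; linarith), him,
        abs_of_pos hθ]
    have hnot : ∀ j, j ≠ i → ∀ᶠ φ : ℝ in 𝓝[>] θ,
        ζ i * Complex.exp (v t φ) ∉ closedSector (ζ j) θ := fun j hj =>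
      ((hcont.tendsto θ).mono_left nhdsWithin_le_nhds).eventually
        (eventually_notMem_closedSector (hζ0 j) hz0
          fun h => (hdisj i j hj.symm).le_bot ⟨hmem, h⟩)
    have hnot' : ∀ᶠ φ : ℝ in 𝓝[>] θ, ∀ j, j ≠ i →
        ζ i * Complex.exp (v t φ) ∉ closedSector (ζ j) θ :=
      eventually_all.2 fun j => by
        by_cases hj : j = i
        · exact Eventually.of_forall fun φ h => absurd hj h
        · filter_upwards [hnot j hj] with φ h _ using h
    filter_upwards [hnot', self_mem_nhdsWithin, Ioo_mem_nhdsGT hθπ] with φ h1 h2 h3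
    have h4 := hrest (ζ i * Complex.exp (v t φ)) (by
      rw [norm_mul, hζ, one_mul, Complex.norm_exp, hre]; exact ht) (by
      intro h
      obtain ⟨j, hj⟩ := Set.mem_iUnion.1 h
      by_cases hji : j = i
      · subst hji
        rw [mul_exp_mem_closedSector_iff (hζ0 j) (by rw [him]; linarith [h3.1])
          (by rw [him]; linarith [h3.2]), him] at hj
        have := le_abs_self φ
        linarith [h3.1]
      · exact h1 j hji hj)
    rwa [norm_mul_exp_rpow (hζ i), hre] at h4
  have hvt : Tendsto (fun t => v t θ) atTop (stripFilter θ) := by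
    refine tendsto_inf.2 ⟨tendsto_comap_iff.2 ?_, tendsto_principal.2 (Eventually.of_forall ?_)⟩
    · simp only [Function.comp_def, hre]; exact tendsto_id
    · intro t; show |(v t θ).im| ≤ θ
      rw [him, abs_of_pos hθ]
  have h5 := (hgrowth.comp hvt).norm
  have h6 : Tendsto (fun t : ℝ => C * Real.exp ((b i).im * θ) *
      Real.exp (-(b i).re * t - (1 - mu) * Real.exp (lam * t))) atTop (𝓝 0) := by
    simpa using (tendsto_exp_sub_exp hlam (sub_pos.2 hmu) (-(b i).re)).const_mul
      (C * Real.exp ((b i).im * θ))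
  -- With `cos(λθ) = 1` the model has full exponential size on the edge, so the smaller bound forces
  -- the quotient to 0, against its limit `A i ≠ 0`.
  have h7 : Tendsto (fun t : ℝ => ‖f (ζ i * Complex.exp (v t θ)) /
      Complex.exp (b i * v t θ + Complex.exp (lam * v t θ))‖) atTop (𝓝 0) := by
    refine squeeze_zero' (Eventually.of_forall fun t => norm_nonneg _) ?_ h6
    filter_upwards [Real.tendsto_exp_atTop.eventually_ge_atTop R] with t ht
    rw [norm_div, Complex.norm_exp, Complex.add_re, exp_lam_mul_re, Complex.mul_re, hre, him, hcos,
      div_le_iff₀ (Real.exp_pos _)]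
    refine (hedge t ht).trans (le_of_eq ?_)
    rw [mul_assoc, mul_assoc, ← Real.exp_add, ← Real.exp_add]
    congr 2; ring
  exact hA (norm_eq_zero.1 (tendsto_nhds_unique h5 h7))

/-- Rotating a small sector inside a larger one. -/
theorem mem_closedSector_rotate_iff {ζ z : ℂ} (hζ : ζ ≠ 0) (hz : z ≠ 0) {s ε : ℝ}
    (hs : |s| + ε < Real.pi) :
    z ∈ closedSector (ζ * Complex.exp (s * Complex.I)) ε ↔ |(z / ζ).arg - s| ≤ ε := by
  have hs1 := le_abs_self s
  have hs2 := neg_abs_le s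
  have hs3 := abs_nonneg s
  set e := Complex.exp (s * Complex.I) with he
  have he0 : e ≠ 0 := Complex.exp_ne_zero _
  have hy : z / ζ ≠ 0 := div_ne_zero hz hζ
  have hdiv : z / (ζ * e) = z / ζ / e := by rw [div_div]
  simp only [closedSector, Set.mem_ofPred_eq, hz, ne_eq, not_false_eq_true, true_and]
  rw [hdiv]
  constructor
  · intro h
    have h' := abs_le.1 h
    have h1 : z / ζ = Complex.exp (Complex.log (z / ζ / e) + s * Complex.I) := by
      rw [Complex.exp_add, Complex.exp_log (div_ne_zero hy he0), ← he, div_mul_cancel₀ _ he0]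
    have h2 : (Complex.log (z / ζ / e) + s * Complex.I).im = (z / ζ / e).arg + s := by
      simp [Complex.log_im]
    rw [h1, arg_exp_of_mem_Ioc (by rw [h2]; linarith) (by rw [h2]; linarith), h2,
      add_sub_cancel_right]
    exact h
  · intro h
    have h' := abs_le.1 h
    have h1 : z / ζ / e = Complex.exp (Complex.log (z / ζ) - s * Complex.I) := by
      rw [Complex.exp_sub, Complex.exp_log hy]
    have h2 : (Complex.log (z / ζ) - s * Complex.I).im = (z / ζ).arg - s := by
      simp [Complex.log_im]
    rw [h1, arg_exp_of_mem_Ioc (by rw [h2]; linarith) (by rw [h2]; linarith), h2]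
    exact h

end Reduction

/-! ### Splitting wide sectors into narrow ones around the maximal rays -/

section SaddleDirections

/-- The angular offsets, within a sector, of the rays on which `z ^ lam` is positive. -/
def saddleOffset (lam : ℝ) (j : ℤ) : ℝ :=
  2 * Real.pi * j / lam

theorem finite_saddleOffset {lam : ℝ} (hlam : 0 < lam) (θ : ℝ) :
    {j : ℤ | |saddleOffset lam j| < θ}.Finite := by
  refine (Set.finite_Icc (-⌈θ * lam / (2 * Real.pi)⌉) ⌈θ * lam / (2 * Real.pi)⌉).subset fun j hj => ?_
  have hj' : |saddleOffset lam j| < θ := hj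
  have h1 : |(j : ℝ)| ≤ ⌈θ * lam / (2 * Real.pi)⌉ := by
    refine le_trans ?_ (Int.le_ceil _)
    rw [saddleOffset, abs_div, abs_mul, abs_of_pos hlam, abs_of_pos Real.two_pi_pos,
      div_lt_iff₀ hlam] at hj'
    rw [le_div_iff₀ Real.two_pi_pos]
    linarith
  have h2 := abs_le.1 h1
  exact ⟨by exact_mod_cast h2.1, by exact_mod_cast h2.2⟩

theorem lam_mul_saddleOffset {lam : ℝ} (hlam : 0 < lam) (j : ℤ) :
    lam * saddleOffset lam j = j * (2 * Real.pi) := by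
  rw [saddleOffset]; field_simp

/-- A function with maximal growth in finitely many disjoint sectors of arbitrary width has saddle
data with respect to sectors narrow enough to contain one maximal ray each. -/
theorem exists_hasSaddles {ι : Type*} [Finite ι] {f : ℂ → ℂ} {lam mu θ : ℝ} {A b ζ : ι → ℂ}
    (hf : Continuous f) (hlam : 0 < lam) (hmu : mu < 1) (hθ : 0 < θ) (hθπ : θ < Real.pi)
    (hζ : ∀ i, ‖ζ i‖ = 1) (hA : ∀ i, A i ≠ 0)
    (hdisj : ∀ i j, i ≠ j → Disjoint (closedSector (ζ i) θ) (closedSector (ζ j) θ))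
    (hrest : ∃ C R : ℝ, ∀ z, R ≤ ‖z‖ → z ∉ ⋃ i, closedSector (ζ i) θ →
      ‖f z‖ ≤ C * Real.exp (mu * ‖z‖ ^ lam))
    (hgrowth : ∀ i, Tendsto
      (fun v => f (ζ i * Complex.exp v) / Complex.exp (b i * v + Complex.exp (lam * v)))
      (stripFilter θ) (𝓝 (A i))) :
    ∃ ε mu' : ℝ, 0 < ε ∧ ε < Real.pi ∧ lam * ε ≤ Real.pi ∧ mu' < 1 ∧
      HasSaddles (ι := ι × {j : ℤ | |saddleOffset lam j| < θ}) f lam mu' ε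
        (fun p => A p.1 * Complex.exp (b p.1 * (saddleOffset lam p.2 * Complex.I)))
        (fun p => b p.1)
        (fun p => ζ p.1 * Complex.exp (saddleOffset lam p.2 * Complex.I)) := by
  have hζ0 : ∀ j, ζ j ≠ 0 := fun j hj => by simpa [hj] using hζ j
  obtain ⟨C, R, hCR⟩ := hrest
  have hcos : Nonempty ι → Real.cos (lam * θ) ≠ 1 := fun ⟨i⟩ =>
    cos_ne_one_of_growth hf hlam hmu hθ hθπ hζ hdisj hCR i (hA i) (hgrowth i)
  have hfin := finite_saddleOffset hlam θ
  have hε : ∀ᶠ ε : ℝ in 𝓝[>] 0, ∀ j ∈ {j : ℤ | |saddleOffset lam j| < θ},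
      |saddleOffset lam j| + ε < θ := by
    rw [eventually_all_finite hfin]
    intro j hj
    have : Tendsto (fun ε : ℝ => |saddleOffset lam j| + ε) (𝓝[>] 0) (𝓝 (|saddleOffset lam j| + 0)) :=
      ((continuous_const.add continuous_id).tendsto 0).mono_left nhdsWithin_le_nhds
    rw [add_zero] at this
    exact this.eventually_lt_const hj
  -- Small enough that each narrow sector stays inside its wide one, and below `π/λ`, half the
  -- spacing of the maximal rays.
  obtain ⟨ε, hεJ, hεI⟩ := (hε.and (Ioo_mem_nhdsGT (div_pos Real.pi_pos hlam))).exists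
  have hε0 : 0 < ε := hεI.1
  have hlε : lam * ε < Real.pi := by
    have := (lt_div_iff₀ hlam).1 hεI.2; linarith
  have h0mem : (0 : ℤ) ∈ {j : ℤ | |saddleOffset lam j| < θ} := by
    show |saddleOffset lam 0| < θ
    simpa [saddleOffset] using hθ
  have hεθ : ε < θ := by
    have := hεJ 0 h0mem
    simpa [saddleOffset] using this
  have hrot : ∀ (i : ι) (j : {j : ℤ | |saddleOffset lam j| < θ}) (z : ℂ), z ≠ 0 →
      (z ∈ closedSector (ζ i * Complex.exp (saddleOffset lam j * Complex.I)) ε ↔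
        |(z / ζ i).arg - saddleOffset lam j| ≤ ε) := fun i j z hz =>
    mem_closedSector_rotate_iff (hζ0 i) hz ((hεJ j j.2).trans hθπ)
  have hdisj' : ∀ p q : ι × {j : ℤ | |saddleOffset lam j| < θ}, p ≠ q →
      Disjoint (closedSector (ζ p.1 * Complex.exp (saddleOffset lam p.2 * Complex.I)) ε)
        (closedSector (ζ q.1 * Complex.exp (saddleOffset lam q.2 * Complex.I)) ε) := by
    intro p q hpq
    rw [Set.disjoint_left]
    intro z hzp hzq
    have hz := hzp.1
    rw [hrot _ _ z hz] at hzp hzq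
    have hbig : ∀ p : ι × {j : ℤ | |saddleOffset lam j| < θ},
        |(z / ζ p.1).arg - saddleOffset lam p.2| ≤ ε → z ∈ closedSector (ζ p.1) θ := fun p hp => by
      refine ⟨hz, ?_⟩
      have h1 := hεJ p.2 p.2.2
      have h2 := abs_add_le ((z / ζ p.1).arg - saddleOffset lam p.2) (saddleOffset lam p.2)
      rw [sub_add_cancel] at h2
      linarith
    by_cases h1 : p.1 = q.1
    · have hne : (p.2 : ℤ) ≠ q.2 := fun h => hpq (Prod.ext h1 (Subtype.ext h))
      have hint : (1 : ℝ) ≤ |((p.2 : ℤ) : ℝ) - ((q.2 : ℤ) : ℝ)| := by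
        exact_mod_cast Int.one_le_abs (sub_ne_zero.2 hne)
      rw [h1] at hzp
      have h3 := abs_sub_le (saddleOffset lam p.2) (z / ζ q.1).arg (saddleOffset lam q.2)
      rw [abs_sub_comm (saddleOffset lam p.2) (z / ζ q.1).arg] at h3
      have h4 : lam * |saddleOffset lam p.2 - saddleOffset lam q.2|
          = |((p.2 : ℤ) : ℝ) - ((q.2 : ℤ) : ℝ)| * (2 * Real.pi) := by
        have habs : ∀ y : ℝ, lam * |y| = |lam * y| := fun y => by rw [abs_mul, abs_of_pos hlam]
        rw [habs, mul_sub, lam_mul_saddleOffset hlam,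
          lam_mul_saddleOffset hlam, ← sub_mul, abs_mul, abs_of_pos Real.two_pi_pos]
      have h5 : lam * |saddleOffset lam p.2 - saddleOffset lam q.2| ≤ lam * (ε + ε) :=
        mul_le_mul_of_nonneg_left (by linarith) hlam.le
      nlinarith [Real.pi_pos]
    · exact (hdisj _ _ h1).le_bot ⟨hbig p hzp, hbig q hzq⟩
  have hnorm : ∀ p : ι × {j : ℤ | |saddleOffset lam j| < θ},
      ‖ζ p.1 * Complex.exp (saddleOffset lam p.2 * Complex.I)‖ = 1 := fun p => by
    rw [norm_mul, hζ, Complex.norm_exp_ofReal_mul_I, one_mul]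
  -- The angles of a wide sector left uncovered by the open narrow arcs. No maximal ray lies there,
  -- the edge being excluded by `hcos`, so compactness keeps `cos(λφ)` away from 1.
  set M : Set ℝ := Set.Icc (-θ) θ ∩
    ⋂ j : {j : ℤ | |saddleOffset lam j| < θ}, {φ | ε ≤ |φ - saddleOffset lam j|} with hM
  have hMc : IsCompact M := isCompact_Icc.inter_right
    (isClosed_iInter fun j => isClosed_le continuous_const (by fun_prop))
  have hMcos : Nonempty ι → ∀ φ ∈ M, Real.cos (lam * φ) < 1 := by
    intro hι φ hφ
    refine lt_of_le_of_ne (Real.cos_le_one _) fun h => ?_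
    obtain ⟨k, hk⟩ := (Real.cos_eq_one_iff _).1 h
    have hk' : φ = saddleOffset lam k := by
      rw [← lam_mul_saddleOffset hlam] at hk
      exact (mul_left_cancel₀ hlam.ne' hk).symm
    have hle : |φ| ≤ θ := abs_le.2 hφ.1
    have hlt : |φ| < θ := by
      refine lt_of_le_of_ne hle fun he => hcos hι ?_
      rw [← he, ← abs_of_pos hlam, ← abs_mul, Real.cos_abs]
      exact h
    rw [hk'] at hlt
    have := Set.mem_iInter.1 hφ.2 ⟨k, hlt⟩
    rw [Set.mem_ofPred_eq, hk', sub_self, abs_zero] at this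
    linarith
  obtain ⟨c, hc1, hc⟩ : ∃ c < 1, Nonempty ι → ∀ φ ∈ M, Real.cos (lam * φ) ≤ c := by
    by_cases hι : Nonempty ι ∧ M.Nonempty
    · obtain ⟨φ₀, hφ₀, hmax⟩ := hMc.exists_isMaxOn hι.2
        (f := fun φ => Real.cos (lam * φ)) (Continuous.continuousOn (by fun_prop))
      exact ⟨_, hMcos hι.1 φ₀ hφ₀, fun _ φ hφ => hmax hφ⟩
    · exact ⟨0, one_pos, fun h1 φ hφ => absurd ⟨h1, φ, hφ⟩ hι⟩
  -- The midpoint of `c` and 1 is still below 1 and leaves a margin `(1 - c)/2` in the exponent to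
  -- absorb the power factor and the constants.
  refine ⟨ε, max mu ((1 + c) / 2), hε0, hεθ.trans hθπ, hlε.le, max_lt hmu (by linarith), hnorm,
    ?_, ?_, hdisj', ?_, ?_⟩
  · intro p q hpq h
    have hp0 : ζ p.1 * Complex.exp (saddleOffset lam p.2 * Complex.I) ≠ 0 :=
      mul_ne_zero (hζ0 _) (Complex.exp_ne_zero _)
    have hin : ζ p.1 * Complex.exp (saddleOffset lam p.2 * Complex.I) ∈
        closedSector (ζ p.1 * Complex.exp (saddleOffset lam p.2 * Complex.I)) ε :=
      ⟨hp0, by rw [div_self hp0, Complex.arg_one, abs_zero]; exact hε0.le⟩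
    have hd := hdisj' p q hpq
    rw [← h] at hd
    exact hd.le_bot ⟨hin, hin⟩
  · exact fun p => mul_ne_zero (hA _) (Complex.exp_ne_zero _)
  · intro p
    set s := saddleOffset lam p.2 with hs
    have ht : Tendsto (fun v : ℂ => v + s * Complex.I) (stripFilter ε) (stripFilter θ) := by
      refine fun S hS => ?_
      obtain ⟨T, hT⟩ := mem_stripFilter_iff.1 (show ∀ᶠ v in stripFilter θ, v ∈ S from hS)
      refine mem_stripFilter_iff.2 ⟨T, fun v h1 h2 => hT _ (by simpa using h1) ?_⟩
      have h3 := hεJ p.2 p.2.2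
      have h4 := abs_add_le v.im s
      simp only [Complex.add_im, Complex.im_ofReal_mul, Complex.I_im, mul_one]
      linarith
    have h1 := ((hgrowth p.1).comp ht).mul_const (Complex.exp (b p.1 * (s * Complex.I)))
    refine h1.congr fun v => ?_
    -- Turning by an offset `2πj/λ` leaves the dominant exponential unchanged; only the power
    -- contributes a constant, which goes into the new coefficient.
    have h2 : Complex.exp (lam * (v + s * Complex.I)) = Complex.exp (lam * v) := by
      have h3 : (lam : ℂ) * (s * Complex.I) = ((p.2 : ℤ) : ℂ) * (2 * Real.pi * Complex.I) := by
        have := lam_mul_saddleOffset hlam p.2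
        rw [← mul_assoc, ← Complex.ofReal_mul, this]
        push_cast; ring
      rw [mul_add, h3, Complex.exp_add, Complex.exp_int_mul_two_pi_mul_I, mul_one]
    rw [Function.comp_apply, h2, mul_add, add_right_comm, Complex.exp_add _ (b p.1 * _),
      Complex.exp_add v, mul_comm (Complex.exp v), ← mul_assoc]
    have := Complex.exp_ne_zero (b p.1 * (s * Complex.I))
    have := Complex.exp_ne_zero (b p.1 * v + Complex.exp (lam * v))
    field_simp
  · have hbd : ∀ᶠ t : ℝ in atTop, ∀ i, ∀ φ ∈ M, ‖f (ζ i * Complex.exp (t + φ * Complex.I))‖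
        ≤ Real.exp (max mu ((1 + c) / 2) * Real.exp (lam * t)) := by
      refine eventually_all.2 fun i => ?_
      obtain ⟨T, hT⟩ := mem_stripFilter_iff.1
        ((hgrowth i).norm.eventually_le_const (lt_add_one ‖A i‖))
      have h1 := (tendsto_exp_sub_exp hlam (show 0 < (1 - c) / 2 by linarith) (b i).re).const_mul
        ((‖A i‖ + 1) * Real.exp (|(b i).im| * θ))
      rw [mul_zero] at h1
      filter_upwards [h1.eventually_le_const one_pos, eventually_ge_atTop T] with t h2 ht φ hφ
      have hφ' := abs_le.2 hφ.1
      set v : ℂ := t + φ * Complex.I with hv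
      have hre : v.re = t := by simp [hv]
      have him : v.im = φ := by simp [hv]
      have h3 := hT v (by rw [hre]; exact ht) (by rw [him]; exact hφ')
      rw [norm_div, div_le_iff₀ (norm_pos_iff.2 (Complex.exp_ne_zero _)), Complex.norm_exp,
        Complex.add_re, exp_lam_mul_re, Complex.mul_re, hre, him] at h3
      have h4 : -((b i).im * φ) ≤ |(b i).im| * θ := by
        refine (neg_le_abs _).trans ?_
        rw [abs_mul]
        exact mul_le_mul_of_nonneg_left hφ' (abs_nonneg _)
      have h5 : Real.exp (lam * t) * Real.cos (lam * φ) ≤ Real.exp (lam * t) * c :=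
        mul_le_mul_of_nonneg_left (hc ⟨i⟩ φ hφ) (Real.exp_pos _).le
      calc _ ≤ _ := h3
        _ ≤ (‖A i‖ + 1) * Real.exp (|(b i).im| * θ + ((b i).re * t - (1 - c) / 2 * Real.exp (lam * t))
            + (1 + c) / 2 * Real.exp (lam * t)) := by
          refine mul_le_mul_of_nonneg_left (Real.exp_le_exp.2 ?_) (by positivity)
          linarith
        _ = (‖A i‖ + 1) * Real.exp (|(b i).im| * θ) *
            Real.exp ((b i).re * t - (1 - c) / 2 * Real.exp (lam * t)) *
            Real.exp ((1 + c) / 2 * Real.exp (lam * t)) := by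
          rw [Real.exp_add, Real.exp_add]; ring
        _ ≤ 1 * Real.exp ((1 + c) / 2 * Real.exp (lam * t)) :=
          mul_le_mul_of_nonneg_right h2 (Real.exp_pos _).le
        _ ≤ _ := by
          rw [one_mul]
          exact Real.exp_le_exp.2 (mul_le_mul_of_nonneg_right (le_max_right _ _) (Real.exp_pos _).le)
    obtain ⟨T, hT⟩ := eventually_atTop.1 hbd
    refine ⟨max C 1, max R (Real.exp T), fun z hz hnot => ?_⟩
    have hzpos : 0 < ‖z‖ := (Real.exp_pos T).trans_le ((le_max_right _ _).trans hz)
    have hz0 : z ≠ 0 := norm_pos_iff.1 hzpos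
    by_cases hbig : z ∈ ⋃ i, closedSector (ζ i) θ
    · obtain ⟨i, hi⟩ := Set.mem_iUnion.1 hbig
      have hzi : z / ζ i ≠ 0 := div_ne_zero hz0 (hζ0 i)
      have hze : z = ζ i * Complex.exp ((Real.log ‖z‖ : ℝ) + (z / ζ i).arg * Complex.I) := by
        have h1 : ((Real.log ‖z‖ : ℝ) : ℂ) + (z / ζ i).arg * Complex.I = Complex.log (z / ζ i) := by
          rw [Complex.log, norm_div, hζ, div_one]
        rw [h1, Complex.exp_log hzi, mul_div_cancel₀ _ (hζ0 i)]
      have hTz : T ≤ Real.log ‖z‖ := by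
        rw [Real.le_log_iff_exp_le hzpos]; exact (le_max_right _ _).trans hz
      have hmem : (z / ζ i).arg ∈ M := by
        refine ⟨abs_le.1 hi.2, Set.mem_iInter.2 fun j => ?_⟩
        by_contra hlt
        exact hnot (Set.mem_iUnion.2 ⟨(i, j), (hrot i j z hz0).2 (not_le.1 hlt).le⟩)
      have h1 := hT _ hTz i _ hmem
      rw [← hze, mul_comm lam, Real.exp_mul _ lam, Real.exp_log hzpos] at h1
      exact h1.trans (le_mul_of_one_le_left (Real.exp_pos _).le (le_max_right _ _))
    · refine (hCR z ((le_max_left _ _).trans hz) hbig).trans ?_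
      refine mul_le_mul (le_max_left _ _) (Real.exp_le_exp.2 ?_) (Real.exp_pos _).le
        (le_max_of_le_right zero_le_one)
      exact mul_le_mul_of_nonneg_right (le_max_left _ _) (by positivity)

end SaddleDirections

end

/-! ### The main theorem -/

theorem mainTheorem7 {m : ℕ} (f : ℂ → ℂ) (lam mu θ : ℝ) (a : ℂ) (A b ζ : Fin m → ℂ)
    (hf : Differentiable ℂ f)
    (hlam : 0 < lam) (hmu : mu < 1) (hθ : θ ∈ Set.Ioo 0 Real.pi)
    (hζ_norm : ∀ k, ‖ζ k‖ = 1) (hζ_one : ∀ k, ζ k ≠ 1) (hζ_inj : ∀ j k, j ≠ k → ζ j ≠ ζ k)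
    (hdisj_one : ∀ k, Disjoint (closedSector 1 θ) (closedSector (ζ k) θ))
    (hdisj : ∀ j k, j ≠ k → Disjoint (closedSector (ζ j) θ) (closedSector (ζ k) θ))
    (hgrowth : HasMaximalGrowth f lam mu θ a A b ζ) :
    (∀ K : Set ℂ, IsCompact K → K ⊆ {w : ℂ | w.re < 0} →
      TendstoUniformlyOn
        (fun (n : ℕ) (w : ℂ) =>
          maclaurinSum f (n - 1) ((scalingRadius lam n : ℂ) * (1 + w / (Real.sqrt n : ℂ))) /
            f ((scalingRadius lam n : ℂ) * (1 + w / (Real.sqrt n : ℂ))))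
        (fun w => 1 / 2 * cerfc (w * (Real.sqrt (lam / 2) : ℂ)))
        atTop K) ↔
      ∀ k, (b k).re - a.re < lam / 2 := by
  obtain ⟨hθ0, hθπ⟩ := hθ
  -- The direction 1 joins the others as index `none`.
  set ζ' : Option (Fin m) → ℂ := fun i => i.elim 1 ζ with hζ'
  set b' : Option (Fin m) → ℂ := fun i => i.elim a b with hb'
  set A' : Option (Fin m) → ℂ := fun i => i.elim 1 A with hA'
  have hnorm : ∀ i, ‖ζ' i‖ = 1 := by
    rintro (_ | k)
    · simp [hζ']
    · exact hζ_norm k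
  have hdisj' : ∀ i j, i ≠ j → Disjoint (closedSector (ζ' i) θ) (closedSector (ζ' j) θ) := by
    rintro (_ | j) (_ | k) h
    · exact absurd rfl h
    · exact hdisj_one k
    · exact (hdisj_one j).symm
    · exact hdisj j k fun e => h (e ▸ rfl)
  have hgr : ∀ i, Tendsto
      (fun v => f (ζ' i * Complex.exp v) / Complex.exp (b' i * v + Complex.exp (lam * v)))
      (stripFilter θ) (𝓝 (A' i)) := by
    rintro (_ | k)
    · exact tendsto_div_of_isEquivalent (hnorm none) hθπ hgrowth.main
    · exact tendsto_div_of_isEquivalent (hnorm (some k)) hθπ (hgrowth.other k)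
  have hne := stripFilter_neBot hθ0
  have hA : ∀ i, A' i ≠ 0 := by
    rintro (_ | k)
    · exact one_ne_zero
    -- If `A k = 0`, then `f` vanishes identically away from 0, which contradicts its growth in
    -- direction 1.
    · intro hAk
      have hAk' : A k = 0 := hAk
      have h1 := hgrowth.other k
      have h2 : directionModel lam (A k) (b k) (ζ k) = 0 := by
        ext z; simp [directionModel, hAk']
      rw [h2, isEquivalent_zero_iff_eventually_zero] at h1
      have h3 := eq_zero_of_eventually_strip hf (ζ := ζ k)
        (fun h => by simpa [h] using hζ_norm k) hθ0
        ((tendsto_mul_exp_stripFilter (hζ_norm k) hθπ).eventually h1)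
      have h4 := hgr none
      have h5 : Tendsto (fun v => f (ζ' none * Complex.exp v) /
          Complex.exp (b' none * v + Complex.exp (lam * v))) (stripFilter θ) (𝓝 0) := by
        refine tendsto_const_nhds.congr fun v => ?_
        rw [h3 (ζ' none * Complex.exp v) (mul_ne_zero (show (1 : ℂ) ≠ 0 from one_ne_zero) (Complex.exp_ne_zero _)), zero_div]
      exact one_ne_zero (tendsto_nhds_unique h4 h5)
  have hrest : ∃ C R : ℝ, ∀ z, R ≤ ‖z‖ → z ∉ ⋃ i, closedSector (ζ' i) θ →
      ‖f z‖ ≤ C * Real.exp (mu * ‖z‖ ^ lam) := by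
    obtain ⟨C, hC⟩ := isBigO_iff.1 hgrowth.rest
    obtain ⟨R, hR⟩ := eventually_cobounded_inf_principal_iff.1 hC
    refine ⟨C, R, fun z hz hnot => ?_⟩
    have := hR z hz (by
      rintro (h | h)
      · exact hnot (Set.mem_iUnion.2 ⟨none, h⟩)
      · obtain ⟨k, hk⟩ := Set.mem_iUnion.1 h
        exact hnot (Set.mem_iUnion.2 ⟨some k, hk⟩))
    rwa [Real.norm_of_nonneg (Real.exp_pos _).le] at this
  obtain ⟨ε, mu', hε0, hεπ, hlε, hmu', hs⟩ :=
    exists_hasSaddles hf.continuous hlam hmu hθ0 hθπ hnorm hA hdisj' hrest hgr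
  have h0mem : |saddleOffset lam 0| < θ := by simpa [saddleOffset] using hθ0
  have hoff : saddleOffset lam 0 = 0 := by simp [saddleOffset]
  have : Finite {j : ℤ | |saddleOffset lam j| < θ} := (finite_saddleOffset hlam θ).to_subtype
  have := Fintype.ofFinite {j : ℤ | |saddleOffset lam j| < θ}
  rw [hs.section_limit_iff hf hlam hmu' hε0 hεπ hlε (none, ⟨0, h0mem⟩) (by simp [hoff, hζ'])
    (by simp [hoff, hA'])]
  constructor
  · intro h k
    exact h (some k, ⟨0, h0mem⟩) (by simp)
  -- Additional rays in the sector around 1 have exponent `a`, so their condition is just `0 < λ/2`;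
  -- rays in the sector around `ζ k` repeat the condition on `b k`.
  · rintro h ⟨_ | k, j⟩ -
    · simpa [hb'] using hlam
    · exact h k
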